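/- Consider $n$ nodes in the unit square $\Omega=[0,1]^2$. Initially their positions are independent with a common law, which is either uniform on $\Omega$ (random geometric graph) or the stationary law of the following motion. In every time slot each node independently moves from its position $x$ to a uniformly distributed point of the disk of radius $v_{\max}=v_{\max}(n)\ge 0$ around $x$ (of the part of this disk inside $\Omega$; for $v_{\max}=0$ nodes do not move, and the uniform law is taken as the stationary one). Let $X(t)$ be the vector of positions at the beginning of slot $t$. After the move of slot $t$, two distinct nodes are neighbours if their distance is at most $r=r(n)>0$; let $\mathcal N_i(t+1)$ be the set of neighbours of $i$, let $P_{ij}(t+1)=1/|\mathcal N_i(t+1)|$ if $j\in\mathcal N_i(t+1)$ and $P_{ij}(t+1)=0$ otherwise, and let $N_{S}(t+1)$ be the number of pairs $i\in S$, $j\notin S$ with $j\in\mathcal N_i(t+1)$. The mobile conductance at slot $t$ is $$\Phi_m=\min_{\emptyset\ne S\subset\{1,\dots,n\},\ |S|\le n/2} \mathbb E\Big[\frac1{|S|}\sum_{i\in S,\,j\notin S}P_{ij}(t+1)\,\Big|\,X(t)\Big],$$ and its edge-counting form (with the common contact probability $1/(n\pi r^2)$) is $$\Phi_m'=\min_{\emptyset\ne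 S\subset\{1,\dots,n\},\ |S|\le n/2}\frac{1}{n\pi r^2\,|S|}\,\mathbb E\big[N_S(t+1)\,\big|\,X(t)\big].$$ There is an absolute constant $C_0>0$ such that the following holds for all sequences $v_{\max}(n)\in[0,\sqrt2]$ and $r(n)\in(0,\sqrt2]$ with $v_{\max}+r\ge C_0\sqrt{\log n/n}$ for all large $n$, and for all slots $t=t(n)$. (a) $\Phi_m'=\Theta(\max(v_{\max},r))$: there are absolute constants $c_1,c_2>0$ such that, with probability tending to $1$ as $n\to\infty$, $c_1\max(v_{\max},r)\le\Phi_m'\le c_2\max(v_{\max},r)$. (b) For every $\kappa>0$ there are constants $c_1,c_2>0$, depending only on $\kappa$, such that, if also $n r^2\ge\kappa$ for all large $n$, then with probability tending to $1$ as $n\to\infty$, $c_1\max(v_{\max},r)\le\Phi_m\le c_2\max(v_{\max},r)$; that is, $\Phi_m=\Theta(\max(v_{\max},r))$. -/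

import Mathlib

open MeasureTheory ProbabilityTheory Filter Topology
open scoped ENNReal

namespace MobileGossip

/-- The Euclidean plane. -/
abbrev Plane : Type := EuclideanSpace ℝ (Fin 2)

/-- The unit square `Ω = [0,1]²`, the state space of every node. -/
def square : Set Plane := {x | ∀ i, x i ∈ Set.Icc (0 : ℝ) 1}

lemma measurableSet_square : MeasurableSet square := by
  have h : square = ⋂ i : Fin 2, (fun x : Plane => x i) ⁻¹' Set.Icc (0 : ℝ) 1 := by
    ext x; simp [square]
  rw [h]
  exact MeasurableSet.iInter fun i => (by fun_prop : Measurable fun x : Plane => x i) measurableSet_Icc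

/-- The uniform law on the unit square. -/
noncomputable def uniformLaw : Measure Plane := volume[|square]

/-- The points of the square within distance `v` of `x`. -/
def reach (v : ℝ) (x : Plane) : Set Plane := Metric.closedBall x v ∩ square

lemma measurableSet_reach (v : ℝ) (x : Plane) : MeasurableSet (reach v x) :=
  Metric.isClosed_closedBall.measurableSet.inter measurableSet_square

lemma measurable_volume_reach_inter (v : ℝ) {A : Set Plane} (hA : MeasurableSet A) :
    Measurable fun x => volume (reach v x ∩ A) := by
  have hs : MeasurableSet {p : Plane × Plane | dist p.2 p.1 ≤ v ∧ p.2 ∈ square ∩ A} :=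
    (measurableSet_le (measurable_snd.dist measurable_fst) measurable_const).inter
      (measurable_snd (measurableSet_square.inter hA))
  convert measurable_measure_prodMk_left (ν := (volume : Measure Plane)) hs using 3 with x
  ext y
  simp [reach, Metric.mem_closedBall, and_assoc]

lemma measurable_volume_reach (v : ℝ) : Measurable fun x => volume (reach v x) := by
  simpa using measurable_volume_reach_inter v MeasurableSet.univ

/-- The transition kernel of one node: from `x` it moves to a uniform point of the disk of radius
`v` around `x` (the part of it inside the square); for `v = 0` it does not move. -/
noncomputable def moveKernel (v : ℝ) : Kernel Plane Plane where
  toFun x := if v = 0 then Measure.dirac x else volume[|reach v x]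
  measurable' := by
    by_cases hv : v = 0
    · simpa [hv] using Measure.measurable_dirac
    · simp only [hv, if_false]
      refine Measure.measurable_of_measurable_coe _ fun A hA => ?_
      simp only [cond_apply (measurableSet_reach v _)]
      exact (measurable_volume_reach v).inv.mul (measurable_volume_reach_inter v hA)

/-- The stationary law of `moveKernel v`: its density is proportional to the area of the part of
the disk that lies inside the square. Without motion (`v = 0`) the uniform law is taken. -/
noncomputable def stationaryLaw (v : ℝ) : Measure Plane :=
  if v = 0 then uniformLaw
  else ((uniformLaw.withDensity fun x => volume (reach v x)) Set.univ)⁻¹ •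
    uniformLaw.withDensity fun x => volume (reach v x)

/-- The law of the position of one node at the beginning of slot `t`, for the initial law `μ₀`. -/
noncomputable def lawAt (v : ℝ) (μ₀ : Measure Plane) : ℕ → Measure Plane
  | 0 => μ₀
  | t + 1 => (lawAt v μ₀ t).bind (moveKernel v)

/-- The joint law of the positions `X(t)` of `n` independent nodes. -/
noncomputable def configLaw (n : ℕ) (v : ℝ) (μ₀ : Measure Plane) (t : ℕ) :
    Measure (Fin n → Plane) :=
  Measure.pi fun _ => lawAt v μ₀ t

/-- The joint transition law `Q`: the law of `X(t+1)` given `X(t) = x`; the nodes move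
independently. -/
noncomputable def transition {n : ℕ} (v : ℝ) (x : Fin n → Plane) : Measure (Fin n → Plane) :=
  Measure.pi fun i => moveKernel v (x i)

open Classical in
/-- The neighbours of node `i` in the geometric graph of range `r` on the positions `y`. -/
noncomputable def nbrs {n : ℕ} (r : ℝ) (y : Fin n → Plane) (i : Fin n) : Finset (Fin n) :=
  Finset.univ.filter fun j => j ≠ i ∧ dist (y i) (y j) ≤ r

/-- The probability `P i j` that node `i` contacts node `j`, when the positions are `y`. -/
noncomputable def contactProb {n : ℕ} (r : ℝ) (y : Fin n → Plane) (i j : Fin n) : ℝ :=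
  if j ∈ nbrs r y i then 1 / ((nbrs r y i).card : ℝ) else 0

/-- The number of edges between `S` and its complement, when the positions are `y`. -/
noncomputable def crossEdges {n : ℕ} (r : ℝ) (y : Fin n → Plane) (S : Finset (Fin n)) : ℝ :=
  ∑ i ∈ S, ∑ j ∈ Sᶜ, if j ∈ nbrs r y i then (1 : ℝ) else 0

/-- The node sets over which the minimum in the mobile conductance is taken. -/
abbrev Cut (n : ℕ) : Type := {S : Finset (Fin n) // S.Nonempty ∧ (S.card : ℝ) ≤ (n : ℝ) / 2}

/-- The mobile conductance at the positions `X(t) = x`: the minimum over the cuts `S` of the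
expectation, over the move, of the total contact probability across the cut, divided by `|S|`. -/
noncomputable def mobileConductance {n : ℕ} (v r : ℝ) (x : Fin n → Plane) : ℝ :=
  ⨅ S : Cut n,
    ∫ y, (∑ i ∈ S.1, ∑ j ∈ S.1ᶜ, contactProb r y i j) / (S.1.card : ℝ) ∂(transition v x)

/-- The edge-counting form of the mobile conductance for nodes with uniform positions: the common
contact probability `1 / (n π r²)` times the expected number of edges across the cut after the
move, divided by `|S|`, minimized over the cuts `S`. -/
noncomputable def edgeMobileConductance {n : ℕ} (v r : ℝ) (x : Fin n → Plane) : ℝ :=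
  ⨅ S : Cut n,
    (1 / ((n : ℝ) * Real.pi * r ^ 2)) / (S.1.card : ℝ) *
      ∫ y, crossEdges r y S.1 ∂(transition v x)

/-- Admissible parameter sequences: the speed bound and the range are at most the diameter of the
square, and their sum is at least `C √(log n / n)`. -/
def Admissible (C : ℝ) (v r : ℕ → ℝ) : Prop :=
  ∀ᶠ n : ℕ in atTop, 0 ≤ v n ∧ v n ≤ √2 ∧ 0 < r n ∧ r n ≤ √2 ∧
    C * √(Real.log n / n) ≤ v n + r n

/-- `Φ n` is of the order `g n` with constants `c₁`, `c₂`, with probability tending to one under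
`P n`. -/
def ThetaWhp (P : (n : ℕ) → Measure (Fin n → Plane)) (Φ : (n : ℕ) → (Fin n → Plane) → ℝ)
    (g : ℕ → ℝ) (c₁ c₂ : ℝ) : Prop :=
  Tendsto (fun n => P n {x | c₁ * g n ≤ Φ n x ∧ Φ n x ≤ c₂ * g n}) atTop (𝓝 1)

/-! Checks that `stationaryLaw v` is a stationary probability law of `moveKernel v`. -/

lemma volume_square_ne_top : volume square ≠ ∞ := by
  have hb : Bornology.IsBounded square := by
    refine (Metric.isBounded_closedBall (x := (0 : Plane)) (r := 2)).subset fun x hx => ?_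
    rw [mem_closedBall_zero_iff, EuclideanSpace.norm_eq]
    refine Real.sqrt_le_iff.2 ⟨by norm_num, ?_⟩
    have h0 := hx 0
    have h1 := hx 1
    simp only [Set.mem_Icc] at h0 h1
    simp only [Fin.sum_univ_two, Real.norm_eq_abs, sq_abs]
    nlinarith
  exact hb.measure_lt_top.ne

lemma isOpen_openSquare : IsOpen {x : Plane | ∀ i, x i ∈ Set.Ioo (0 : ℝ) 1} := by
  simp only [Set.ofPred_forall]
  exact isOpen_iInter_of_finite fun i => isOpen_Ioo.preimage (by fun_prop)

lemma volume_openSquare_ne_zero :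
    volume {x : Plane | ∀ i, x i ∈ Set.Ioo (0 : ℝ) 1} ≠ 0 := by
  refine (isOpen_openSquare.measure_pos volume ⟨WithLp.toLp 2 fun _ => 1 / 2, fun i => ?_⟩).ne'
  norm_num

lemma openSquare_subset : {x : Plane | ∀ i, x i ∈ Set.Ioo (0 : ℝ) 1} ⊆ square :=
  fun _ hx i => Set.Ioo_subset_Icc_self (hx i)

lemma volume_square_ne_zero : volume square ≠ 0 := fun h =>
  volume_openSquare_ne_zero (measure_mono_null openSquare_subset h)

instance : IsProbabilityMeasure uniformLaw :=
  cond_isProbabilityMeasure_of_finite volume_square_ne_zero volume_square_ne_top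

lemma isProbabilityMeasure_stationaryLaw {v : ℝ} (hv : 0 ≤ v) :
    IsProbabilityMeasure (stationaryLaw v) := by
  unfold stationaryLaw
  split_ifs with h0
  · infer_instance
  have hpos : 0 < v := lt_of_le_of_ne hv (Ne.symm h0)
  refine ⟨?_⟩
  rw [Measure.smul_apply, smul_eq_mul, withDensity_apply _ MeasurableSet.univ,
    Measure.restrict_univ]
  refine ENNReal.inv_mul_cancel ?_ ?_
  · rw [Ne, lintegral_eq_zero_iff (measurable_volume_reach v)]
    intro h
    have h2 : uniformLaw {x : Plane | ∀ i, x i ∈ Set.Ioo (0 : ℝ) 1} = 0 := by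
      refine measure_mono_null (fun x hx => ?_) (ae_iff.1 h)
      have hop : IsOpen (Metric.ball x v ∩ {x : Plane | ∀ i, x i ∈ Set.Ioo (0 : ℝ) 1}) :=
        Metric.isOpen_ball.inter isOpen_openSquare
      have hp := hop.measure_pos volume ⟨x, Metric.mem_ball_self hpos, hx⟩
      have hle := measure_mono (μ := volume)
        (Set.inter_subset_inter (Metric.ball_subset_closedBall (x := x) (ε := v))
          openSquare_subset)
      exact (hp.trans_le hle).ne'
    rw [uniformLaw, cond_apply measurableSet_square,
      Set.inter_eq_self_of_subset_right openSquare_subset, mul_eq_zero] at h2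
    rcases h2 with h2 | h2
    · exact volume_square_ne_top (ENNReal.inv_eq_zero.1 h2)
    · exact volume_openSquare_ne_zero h2
  · refine ne_top_of_le_ne_top volume_square_ne_top ?_
    calc ∫⁻ x, volume (reach v x) ∂uniformLaw
        ≤ ∫⁻ _, volume square ∂uniformLaw :=
          lintegral_mono fun x => measure_mono Set.inter_subset_right
      _ = volume square := by simp

theorem invariant_stationaryLaw (v : ℝ) : Kernel.Invariant (moveKernel v) (stationaryLaw v) := by
  by_cases hv : v = 0
  · have h : ⇑(moveKernel v) = Measure.dirac := by
      funext x; change (if v = 0 then _ else _) = _; simp [hv]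
    rw [Kernel.Invariant, h, Measure.bind_dirac]
  rw [Kernel.Invariant]
  ext A hA
  rw [Measure.bind_apply hA (moveKernel v).measurable.aemeasurable, stationaryLaw, if_neg hv,
    lintegral_smul_measure, Measure.smul_apply]
  congr 1
  rw [lintegral_withDensity_eq_lintegral_mul _ (measurable_volume_reach v)
    ((moveKernel v).measurable_coe hA), withDensity_apply _ hA]
  have h1 : ∀ x, ((fun x => volume (reach v x)) * fun x => moveKernel v x A) x
      = volume (reach v x ∩ A) := by
    intro x
    have hk : moveKernel v x = volume[|reach v x] := by
      change (if v = 0 then _ else _) = _; simp [hv]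
    simp only [Pi.mul_apply, hk, cond_apply (measurableSet_reach v x)]
    by_cases h0 : volume (reach v x) = 0
    · rw [h0, zero_mul, measure_mono_null Set.inter_subset_left h0]
    · rw [← mul_assoc, ENNReal.mul_inv_cancel h0, one_mul]
      exact ne_top_of_le_ne_top volume_square_ne_top (measure_mono Set.inter_subset_right)
  simp only [h1]
  have hS : ∀ (B : Set Plane) (x : Plane), MeasurableSet B → volume (reach v x ∩ B)
      = ∫⁻ y in square ∩ B, (Metric.closedBall x v).indicator 1 y := by
    intro B x hB
    rw [lintegral_indicator_one Metric.isClosed_closedBall.measurableSet,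
      Measure.restrict_apply Metric.isClosed_closedBall.measurableSet, reach, Set.inter_assoc]
  have hS' : ∀ x : Plane, volume (reach v x)
      = ∫⁻ y in square, (Metric.closedBall x v).indicator 1 y := by
    intro x; simpa using hS Set.univ x MeasurableSet.univ
  rw [uniformLaw, ProbabilityTheory.cond, lintegral_smul_measure, Measure.restrict_smul, lintegral_smul_measure,
    Measure.restrict_restrict hA]
  congr 1
  simp only [hS A _ hA, hS']
  rw [lintegral_lintegral_swap, Set.inter_comm A]
  · refine lintegral_congr fun y => lintegral_congr fun x => ?_
    simp [Set.indicator, Metric.mem_closedBall, dist_comm]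
  · have hs : MeasurableSet {p : Plane × Plane | dist p.2 p.1 ≤ v} :=
      measurableSet_le (by fun_prop) (by fun_prop)
    exact ((measurable_one (α := ℝ≥0∞)).indicator hs).aemeasurable

end MobileGossip

/-!
The proof reduces everything to one typical property of the positions. Put `d = max v r` and divide
the square into a grid of cells of side of order `d`. The uniform and the stationary law have
densities within constant factors of each other, and this persists in time
(`lawAt_bounds_uniformLaw`); hence by Chernoff's bound and `n d² ≥ const * log n`, with probability
tending to one all cells contain a number of nodes of the order of the mean `n d²`
(`measureReal_configLaw_not_balanced_le`). The rest is deterministic in `X(t)`.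

After the move, two nodes at distance at most `d / 16` are neighbours with probability of order
`ρ = (r / d)²`, while this probability never exceeds a multiple of `ρ` and vanishes for nodes at
distance more than `3 d` (`le_prod_moveKernel_dist_le`, `prod_moveKernel_dist_le_le`,
`prod_moveKernel_dist_le_eq_zero`). So the expected number of edges across a cut is `ρ` times the
number of pairs across the cut at distance of order `d`, and the edge-counting conductance is
governed by the edge expansion of the geometric graph of range `d`.

For the lower bound, this expansion is `card_mul_card_compl_le_touchingPairs`. If a fraction `f c`
of the nodes in the cell `c` belongs to `S`, then `f c (1 - f c') + f c' (1 - f c)` is the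
probability that random nodes of the cells `c` and `c'` are on different sides. It satisfies the
triangle inequality, so summation over paths with one horizontal and one vertical segment bounds
the number `|S| |Sᶜ|` of all pairs across the cut by the number of those in touching cells. For the
upper bound, a vertical grid line in the middle of the square is a cut with a constant fraction of
the nodes on each side, and only the nodes within a constant number of columns of cells from this
line have potential neighbours across it (`exists_bisecting_cut`).

For the contact probabilities, the upper bound only needs that a node contacts at most one other
node. In the lower bound, a node has a mean number of neighbours at most of order `n r²`, also when
one neighbour is given, because the others move independently (`transition_nearEvent_inter_le`); by
convexity of the inverse, the expected contact probability is at least the probability of being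
neighbours divided by `1 + const * n r²` (`le_integral_contactProb`), and `n r² ≥ κ` makes this
comparable with the factor `1 / (n π r²)` in the edge-counting form.
-/

namespace MobileGossip

/-! ### Areas of disks in the square -/

lemma setOf_forall_mem_eq_preimage (s : Fin 2 → Set ℝ) :
    {x : Plane | ∀ i, x i ∈ s i} = (WithLp.ofLp : Plane → Fin 2 → ℝ) ⁻¹' Set.univ.pi s := by
  ext x; simp

lemma volume_Icc_box (a b : Fin 2 → ℝ) :
    volume {x : Plane | ∀ i, x i ∈ Set.Icc (a i) (b i)} = ∏ i, ENNReal.ofReal (b i - a i) := by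
  rw [setOf_forall_mem_eq_preimage fun i => Set.Icc (a i) (b i),
    (PiLp.volume_preserving_ofLp (Fin 2)).measure_preimage
      (MeasurableSet.univ_pi fun i => measurableSet_Icc).nullMeasurableSet, volume_pi_pi]
  simp

lemma volume_Ioo_box (a b : Fin 2 → ℝ) :
    volume {x : Plane | ∀ i, x i ∈ Set.Ioo (a i) (b i)} = ∏ i, ENNReal.ofReal (b i - a i) := by
  rw [setOf_forall_mem_eq_preimage fun i => Set.Ioo (a i) (b i),
    (PiLp.volume_preserving_ofLp (Fin 2)).measure_preimage
      (MeasurableSet.univ_pi fun i => measurableSet_Ioo).nullMeasurableSet, volume_pi_pi]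
  simp

lemma volume_square : volume square = 1 := by
  simpa [square] using volume_Icc_box (fun _ => 0) (fun _ => 1)

lemma uniformLaw_apply (A : Set Plane) : uniformLaw A = volume (square ∩ A) := by
  simp [uniformLaw, cond_apply measurableSet_square, volume_square]

lemma abs_coord_sub_le_dist (x y : Plane) (i : Fin 2) : |x i - y i| ≤ dist x y := by
  rw [dist_eq_norm, ← Real.norm_eq_abs]
  exact PiLp.norm_apply_le (x - y) i

lemma dist_le_of_coord {x y : Plane} {s e : ℝ} (he : 0 ≤ e) (hs : 2 * s ^ 2 ≤ e ^ 2)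
    (h : ∀ i, |x i - y i| ≤ s) : dist x y ≤ e := by
  rw [EuclideanSpace.dist_eq, Fin.sum_univ_two, Real.dist_eq, Real.dist_eq]
  refine Real.sqrt_le_iff.2 ⟨he, ?_⟩
  have h0 := sq_le_sq' (by linarith [abs_nonneg (x 0 - y 0), h 0]) (h 0)
  have h1 := sq_le_sq' (by linarith [abs_nonneg (x 1 - y 1), h 1]) (h 1)
  linarith

lemma volume_closedBall_le {v : ℝ} (hv : 0 ≤ v) (x : Plane) :
    volume (Metric.closedBall x v) ≤ ENNReal.ofReal (4 * v ^ 2) := by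
  calc volume (Metric.closedBall x v)
      ≤ volume {y : Plane | ∀ i, y i ∈ Set.Icc (x i - v) (x i + v)} := by
        refine measure_mono fun y hy i => ?_
        have := abs_le.1 ((abs_coord_sub_le_dist y x i).trans hy)
        constructor <;> linarith [this.1, this.2]
    _ = ENNReal.ofReal (4 * v ^ 2) := by
        rw [volume_Icc_box, Fin.prod_univ_two, ← ENNReal.ofReal_mul (by linarith)]
        congr 1; ring

lemma volume_reach_le {v : ℝ} (hv : 0 ≤ v) (x : Plane) :
    volume (reach v x) ≤ ENNReal.ofReal (4 * v ^ 2) :=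
  (measure_mono Set.inter_subset_left).trans (volume_closedBall_le hv x)

/-- From every point of the square there is, in each coordinate, room of length `1/2` on one side,
so a square of side `v / (2√2)` with corner `x` fits into `reach v x`. -/
lemma le_volume_reach {v : ℝ} (hv : 0 ≤ v) (hv' : v ≤ √2) {x : Plane} (hx : x ∈ square) :
    ENNReal.ofReal (v ^ 2 / 8) ≤ volume (reach v x) := by
  have h2 : √2 ^ 2 = 2 := Real.sq_sqrt (by norm_num)
  have h2p : 0 < √2 := by positivity
  set s : ℝ := v * √2 / 4 with hs
  have hs0 : 0 ≤ s := by positivity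
  have hs1 : s ≤ 1 / 2 := by nlinarith
  have hss : s ^ 2 = v ^ 2 / 8 := by rw [hs]; nlinarith
  set a : Fin 2 → ℝ := fun i => if x i ≤ 1 / 2 then x i else x i - s with ha
  calc ENNReal.ofReal (v ^ 2 / 8)
      = volume {y : Plane | ∀ i, y i ∈ Set.Icc (a i) (a i + s)} := by
        rw [volume_Icc_box, Fin.prod_univ_two, ← ENNReal.ofReal_mul (by linarith)]
        congr 1; rw [← hss]; ring
    _ ≤ volume (reach v x) := by
        refine measure_mono fun y hy => ⟨?_, fun i => ?_⟩
        · refine dist_le_of_coord (s := s) hv (by rw [hss]; nlinarith) fun i => ?_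
          have := hy i
          simp only [ha, Set.mem_Icc] at this
          rw [abs_le]
          split_ifs at this <;> constructor <;> linarith [this.1, this.2]
        · have := hy i
          have hxi := hx i
          simp only [ha, Set.mem_Icc] at this hxi ⊢
          split_ifs at this <;> constructor <;> linarith [this.1, this.2, hxi.1, hxi.2]

/-! ### The motion of one node -/

lemma moveKernel_zero_apply (x : Plane) : moveKernel 0 x = Measure.dirac x := by
  change (if (0 : ℝ) = 0 then _ else _) = _
  simp

lemma moveKernel_apply {v : ℝ} (hv : v ≠ 0) (x : Plane) :
    moveKernel v x = volume[|reach v x] := by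
  change (if v = 0 then _ else _) = _
  simp [hv]

lemma isProbabilityMeasure_moveKernel {v : ℝ} (hv : 0 ≤ v) (hv' : v ≤ √2) {x : Plane}
    (hx : x ∈ square) : IsProbabilityMeasure (moveKernel v x) := by
  rcases hv.eq_or_lt with rfl | hpos
  · rw [moveKernel_zero_apply]; infer_instance
  · rw [moveKernel_apply hpos.ne']
    refine cond_isProbabilityMeasure_of_finite (ne_of_gt ?_)
      (ne_top_of_le_ne_top ENNReal.ofReal_ne_top (volume_reach_le hv x))
    exact lt_of_lt_of_le (by rw [ENNReal.ofReal_pos]; positivity) (le_volume_reach hv hv' hx)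

lemma moveKernel_compl_closedBall {v : ℝ} (hv : 0 ≤ v) (x : Plane) :
    moveKernel v x (Metric.closedBall x v)ᶜ = 0 := by
  rcases hv.eq_or_lt with rfl | hpos
  · rw [moveKernel_zero_apply]
    simp
  · rw [moveKernel_apply hpos.ne', cond_apply (measurableSet_reach v x)]
    have : reach v x ∩ (Metric.closedBall x v)ᶜ = ∅ := by
      ext y; simp only [reach, Set.mem_inter_iff, Set.mem_compl_iff]; tauto
    simp [this]

/-- The order of the probability that two nodes whose distance is of the order `max v r` are
neighbours after a move: the squared ratio of the range to `max v r`. -/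
noncomputable def contactRatio (v r : ℝ) : ℝ := (r / max v r) ^ 2

lemma contactRatio_nonneg (v r : ℝ) : 0 ≤ contactRatio v r := sq_nonneg _

lemma contactRatio_le_one {v r : ℝ} (hr : 0 < r) : contactRatio v r ≤ 1 := by
  unfold contactRatio
  have h : r ≤ max v r := le_max_right _ _
  have := (div_le_one (hr.trans_le h)).2 h
  have h0 : 0 ≤ r / max v r := by positivity
  nlinarith

lemma contactRatio_of_le {v r : ℝ} (h : v ≤ r) (hr : 0 < r) : contactRatio v r = 1 := by
  simp [contactRatio, max_eq_right h, hr.ne']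

lemma moveKernel_closedBall_le {v r : ℝ} (hv : 0 ≤ v) (hv' : v ≤ √2) (hr : 0 < r)
    {x : Plane} (hx : x ∈ square) (y : Plane) :
    moveKernel v x (Metric.closedBall y r) ≤ ENNReal.ofReal (32 * contactRatio v r) := by
  have := isProbabilityMeasure_moveKernel hv hv' hx
  rcases le_total v r with hvr | hvr
  · rw [contactRatio_of_le hvr hr]
    exact prob_le_one.trans (by simp)
  · have hpos : 0 < v := hr.trans_le hvr
    rw [moveKernel_apply hpos.ne', cond_apply (measurableSet_reach v x), contactRatio,
      max_eq_left hvr]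
    calc (volume (reach v x))⁻¹ * volume (reach v x ∩ Metric.closedBall y r)
        ≤ (ENNReal.ofReal (v ^ 2 / 8))⁻¹ * ENNReal.ofReal (4 * r ^ 2) := by
          gcongr
          · exact le_volume_reach hv hv' hx
          · exact (measure_mono Set.inter_subset_right).trans (volume_closedBall_le hr.le y)
      _ = ENNReal.ofReal (32 * (r / v) ^ 2) := by
          rw [← ENNReal.ofReal_inv_of_pos (by positivity), ← ENNReal.ofReal_mul (by positivity)]
          congr 1; field_simp; ring

lemma le_moveKernel_closedBall {v s : ℝ} (hv : 0 < v) (hs : 0 ≤ s) (hs' : s ≤ √2)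
    {x y : Plane} (hy : y ∈ square) (h : dist y x + s ≤ v) :
    ENNReal.ofReal (s ^ 2 / (32 * v ^ 2)) ≤ moveKernel v x (Metric.closedBall y s) := by
  rw [moveKernel_apply hv.ne', cond_apply (measurableSet_reach v x)]
  calc ENNReal.ofReal (s ^ 2 / (32 * v ^ 2))
      = (ENNReal.ofReal (4 * v ^ 2))⁻¹ * ENNReal.ofReal (s ^ 2 / 8) := by
        rw [← ENNReal.ofReal_inv_of_pos (by positivity), ← ENNReal.ofReal_mul (by positivity)]
        congr 1; field_simp; ring
    _ ≤ (volume (reach v x))⁻¹ * volume (reach v x ∩ Metric.closedBall y s) := by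
        gcongr
        · exact volume_reach_le hv.le x
        · refine (le_volume_reach hs hs' hy).trans (measure_mono fun z hz => ⟨⟨?_, hz.2⟩, hz.1⟩)
          have h1 := dist_triangle z y x
          have h2 : dist z y ≤ s := hz.1
          exact Metric.mem_closedBall.2 (by linarith)

lemma measurableSet_dist_le (r : ℝ) : MeasurableSet {p : Plane × Plane | dist p.1 p.2 ≤ r} :=
  measurableSet_le (measurable_fst.dist measurable_snd) measurable_const

lemma setOf_dist_le_eq_closedBall (y : Plane) (r : ℝ) :
    Prod.mk y ⁻¹' {p : Plane × Plane | dist p.1 p.2 ≤ r} = Metric.closedBall y r := by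
  ext z; simp [dist_comm]

lemma prod_moveKernel_dist_le_le {v r : ℝ} (hv : 0 ≤ v) (hv' : v ≤ √2) (hr : 0 < r)
    {x x' : Plane} (hx : x ∈ square) (hx' : x' ∈ square) :
    ((moveKernel v x).prod (moveKernel v x')) {p | dist p.1 p.2 ≤ r}
      ≤ ENNReal.ofReal (32 * contactRatio v r) := by
  have := isProbabilityMeasure_moveKernel hv hv' hx
  have := isProbabilityMeasure_moveKernel hv hv' hx'
  rw [Measure.prod_apply (measurableSet_dist_le r)]
  simp only [setOf_dist_le_eq_closedBall]
  calc _ ≤ ∫⁻ _, ENNReal.ofReal (32 * contactRatio v r) ∂(moveKernel v x) :=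
        lintegral_mono fun y => moveKernel_closedBall_le hv hv' hr hx' y
    _ = _ := by simp

/-- Two nodes at distance at most `max v r / 16` become neighbours with probability of the order
`contactRatio v r`. If `v ≤ r / 4`, they cannot fail to; otherwise, the first one lands within
`v / 2` of the second with constant probability, and then the disk of radius `min r (v / 2)` around
it lies in the disk from which the second one chooses its new position. -/
lemma le_prod_moveKernel_dist_le {v r : ℝ} (hv : 0 ≤ v) (hv' : v ≤ √2) (hr : 0 < r)
    (hr' : r ≤ √2) {x x' : Plane} (hx : x ∈ square) (hx' : x' ∈ square)
    (h : dist x x' ≤ max v r / 16) :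
    ENNReal.ofReal (contactRatio v r / 65536)
      ≤ ((moveKernel v x).prod (moveKernel v x')) {p | dist p.1 p.2 ≤ r} := by
  have := isProbabilityMeasure_moveKernel hv hv' hx
  have := isProbabilityMeasure_moveKernel hv hv' hx'
  have hρ0 := contactRatio_nonneg v r
  have hρ1 := contactRatio_le_one (v := v) hr
  rcases le_or_gt v (r / 4) with hvr | hvr
  · rw [max_eq_right (by linarith)] at h
    have h1 : ((moveKernel v x).prod (moveKernel v x')) {p | dist p.1 p.2 ≤ r}ᶜ = 0 := by
      refine measure_mono_null (t := (Metric.closedBall x v)ᶜ ×ˢ Set.univ ∪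
        Set.univ ×ˢ (Metric.closedBall x' v)ᶜ) ?_ ?_
      · rintro ⟨y, z⟩ hyz
        by_contra hcon
        simp only [Set.mem_union, Set.mem_prod, Set.mem_compl_iff, Set.mem_univ, and_true,
          true_and, not_or, not_not, Metric.mem_closedBall] at hcon
        have t1 := dist_triangle y x z
        have t2 := dist_triangle_right x z x'
        exact hyz (show dist y z ≤ r by linarith [hcon.1, hcon.2])
      · refine measure_union_null ?_ ?_ <;>
          simp [Measure.prod_prod, moveKernel_compl_closedBall hv]
    rw [prob_compl_eq_zero_iff (measurableSet_dist_le r)] at h1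
    rw [h1]
    refine ENNReal.ofReal_le_one.2 (by linarith)
  · have hpos : 0 < v := by linarith
    have hxv : dist x x' ≤ v / 4 := by
      rcases max_cases v r with h' | h' <;> linarith
    have hdisk : ∀ y ∈ Metric.closedBall x (v / 4) ∩ square,
        ENNReal.ofReal (contactRatio v r / 128) ≤ moveKernel v x' (Metric.closedBall y r) := by
      intro y hy
      have hy1 : dist y x ≤ v / 4 := hy.1
      have ht := dist_triangle y x x'
      have hs0 : 0 ≤ min r (v / 2) := by positivity
      refine le_trans ?_ ((le_moveKernel_closedBall hpos (s := min r (v / 2)) hs0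
        ((min_le_left _ _).trans hr') hy.2 ?_).trans
          (measure_mono (Metric.closedBall_subset_closedBall (min_le_left _ _))))
      · refine ENNReal.ofReal_le_ofReal ?_
        rcases le_total r (v / 2) with h' | h'
        · rw [min_eq_left h', contactRatio, max_eq_left (by linarith), div_pow, div_div,
            mul_comm (32 : ℝ)]
          gcongr
          norm_num
        · rw [min_eq_right h']
          calc contactRatio v r / 128 ≤ 1 / 128 := by gcongr
            _ = _ := by field_simp; norm_num
      · have := min_le_right r (v / 2)
        linarith
    rw [Measure.prod_apply (measurableSet_dist_le r)]
    simp only [setOf_dist_le_eq_closedBall]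
    have hB : MeasurableSet (Metric.closedBall x (v / 4) ∩ square) :=
      Metric.isClosed_closedBall.measurableSet.inter measurableSet_square
    have hmass : ENNReal.ofReal (1 / 512) ≤
        moveKernel v x (Metric.closedBall x (v / 4) ∩ square) := by
      have h1 := le_moveKernel_closedBall hpos (s := v / 4) (by positivity) (by linarith) hx
        (by rw [dist_self]; linarith)
      have h2 : moveKernel v x (Metric.closedBall x (v / 4) ∩ square)
          = moveKernel v x (Metric.closedBall x (v / 4)) := by
        rw [moveKernel_apply hpos.ne', cond_apply (measurableSet_reach v x),
          cond_apply (measurableSet_reach v x)]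
        congr 2
        ext z; simp only [reach, Set.mem_inter_iff]; tauto
      rw [h2]
      refine le_trans (le_of_eq ?_) h1
      congr 1; field_simp; norm_num
    calc ENNReal.ofReal (contactRatio v r / 65536)
        = ENNReal.ofReal (contactRatio v r / 128) * ENNReal.ofReal (1 / 512) := by
          rw [← ENNReal.ofReal_mul (by positivity)]; congr 1; ring
      _ ≤ ENNReal.ofReal (contactRatio v r / 128) *
          moveKernel v x (Metric.closedBall x (v / 4) ∩ square) := by gcongr
      _ = ∫⁻ _ in Metric.closedBall x (v / 4) ∩ square,
            ENNReal.ofReal (contactRatio v r / 128) ∂(moveKernel v x) := by simp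
      _ ≤ ∫⁻ y in Metric.closedBall x (v / 4) ∩ square,
            moveKernel v x' (Metric.closedBall y r) ∂(moveKernel v x) :=
          setLIntegral_mono' hB hdisk
      _ ≤ _ := setLIntegral_le_lintegral _ _

/-- Nodes at distance more than `3 max v r` cannot become neighbours in one move. -/
lemma prod_moveKernel_dist_le_eq_zero {v r : ℝ} (hv : 0 ≤ v) (hv' : v ≤ √2)
    {x x' : Plane} (hx : x ∈ square) (hx' : x' ∈ square) (h : 3 * max v r < dist x x') :
    ((moveKernel v x).prod (moveKernel v x')) {p | dist p.1 p.2 ≤ r} = 0 := by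
  have := isProbabilityMeasure_moveKernel hv hv' hx
  have := isProbabilityMeasure_moveKernel hv hv' hx'
  refine measure_mono_null (t := (Metric.closedBall x v)ᶜ ×ˢ Set.univ ∪
    Set.univ ×ˢ (Metric.closedBall x' v)ᶜ) ?_ ?_
  · rintro ⟨y, z⟩ hyz
    by_contra hcon
    simp only [Set.mem_union, Set.mem_prod, Set.mem_compl_iff, Set.mem_univ, and_true,
      true_and, not_or, not_not, Metric.mem_closedBall] at hcon
    have t1 := dist_triangle_left x x' y
    have t2 := dist_triangle y z x'
    have h3 : dist y z ≤ r := hyz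
    linarith [hcon.1, hcon.2, le_max_left v r, le_max_right v r]
  · refine measure_union_null ?_ ?_ <;>
      simp [Measure.prod_prod, moveKernel_compl_closedBall hv]

/-! ### The law of the position of a node -/

lemma lintegral_le_of_measure_le {μ ν : Measure Plane} {c : ℝ≥0∞} (h : μ ≤ c • ν)
    (f : Plane → ℝ≥0∞) : ∫⁻ x, f x ∂μ ≤ c * ∫⁻ x, f x ∂ν := by
  simpa using lintegral_mono' h (le_refl f)

lemma stationaryLaw_bounds {v : ℝ} (hv : 0 ≤ v) (hv' : v ≤ √2) :
    stationaryLaw v ≤ (32 : ℝ≥0∞) • uniformLaw ∧ uniformLaw ≤ (32 : ℝ≥0∞) • stationaryLaw v := by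
  rcases hv.eq_or_lt with rfl | hpos
  · have h : uniformLaw ≤ (32 : ℝ≥0∞) • uniformLaw := by
      refine Measure.le_intro fun A _ _ => ?_
      rw [Measure.smul_apply, smul_eq_mul]
      exact le_mul_of_one_le_left' (by norm_num)
    simp only [stationaryLaw, if_true]
    exact ⟨h, h⟩
  have hae : ∀ᵐ x ∂uniformLaw, x ∈ square := by
    rw [ae_iff, uniformLaw_apply]
    have : square ∩ {x | x ∉ square} = ∅ := by ext; simp
    simp [this]
  have hup : ∀ A, MeasurableSet A → (uniformLaw.withDensity fun x => volume (reach v x)) A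
      ≤ ENNReal.ofReal (4 * v ^ 2) * uniformLaw A := by
    intro A hA
    rw [withDensity_apply _ hA]
    calc _ ≤ ∫⁻ _ in A, ENNReal.ofReal (4 * v ^ 2) ∂uniformLaw :=
          lintegral_mono fun x => volume_reach_le hv x
      _ = _ := by simp
  have hlo : ∀ A, MeasurableSet A → ENNReal.ofReal (v ^ 2 / 8) * uniformLaw A
      ≤ (uniformLaw.withDensity fun x => volume (reach v x)) A := by
    intro A hA
    rw [withDensity_apply _ hA]
    calc _ = ∫⁻ _ in A, ENNReal.ofReal (v ^ 2 / 8) ∂uniformLaw := by simp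
      _ ≤ _ := lintegral_mono_ae ((ae_restrict_of_ae hae).mono
        fun x hx => le_volume_reach hv hv' hx)
  have hup1 := hup _ MeasurableSet.univ
  have hlo1 := hlo _ MeasurableSet.univ
  rw [measure_univ (μ := uniformLaw), mul_one] at hup1 hlo1
  have hratio : (ENNReal.ofReal (v ^ 2 / 8))⁻¹ * ENNReal.ofReal (4 * v ^ 2) = 32 := by
    rw [← ENNReal.ofReal_inv_of_pos (by positivity), ← ENNReal.ofReal_mul (by positivity),
      show (v ^ 2 / 8)⁻¹ * (4 * v ^ 2) = 32 by field_simp; norm_num]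
    norm_num
  have hinv : (ENNReal.ofReal (4 * v ^ 2))⁻¹ * ENNReal.ofReal (v ^ 2 / 8) = 32⁻¹ := by
    rw [← hratio, ENNReal.mul_inv (by simp) (by simp [hpos.ne']), inv_inv, mul_comm]
  rw [stationaryLaw, if_neg hpos.ne']
  refine ⟨Measure.le_intro fun A hA _ => ?_, Measure.le_intro fun A hA _ => ?_⟩
  · simp only [Measure.smul_apply, smul_eq_mul]
    calc _ ≤ (ENNReal.ofReal (v ^ 2 / 8))⁻¹ * (ENNReal.ofReal (4 * v ^ 2) * uniformLaw A) := by
          gcongr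
          exact hup A hA
      _ = _ := by rw [← mul_assoc, hratio]
  · simp only [Measure.smul_apply, smul_eq_mul]
    calc uniformLaw A = 32 * ((ENNReal.ofReal (4 * v ^ 2))⁻¹ *
          (ENNReal.ofReal (v ^ 2 / 8) * uniformLaw A)) := by
          rw [← mul_assoc (_)⁻¹, hinv, ← mul_assoc,
            ENNReal.mul_inv_cancel (by norm_num) (by norm_num), one_mul]
      _ ≤ _ := by
          gcongr
          exact hlo A hA

/-- The bounds between the initial and the stationary law persist because both laws are moved by
the same kernel. -/
lemma lawAt_bounds {v : ℝ} {μ₀ : Measure Plane} {c : ℝ≥0∞} (h₁ : μ₀ ≤ c • stationaryLaw v)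
    (h₂ : stationaryLaw v ≤ c • μ₀) (t : ℕ) :
    lawAt v μ₀ t ≤ c • stationaryLaw v ∧ stationaryLaw v ≤ c • lawAt v μ₀ t := by
  induction t with
  | zero => exact ⟨h₁, h₂⟩
  | succ t ih =>
    have hinv : stationaryLaw v = (stationaryLaw v).bind (moveKernel v) :=
      (invariant_stationaryLaw v).symm
    have hm := (moveKernel v).measurable
    constructor
    · refine Measure.le_intro fun A hA _ => ?_
      rw [hinv, Measure.smul_apply, lawAt, Measure.bind_apply hA hm.aemeasurable,
        Measure.bind_apply hA hm.aemeasurable]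
      exact lintegral_le_of_measure_le ih.1 _
    · refine Measure.le_intro fun A hA _ => ?_
      rw [hinv, Measure.smul_apply, lawAt, Measure.bind_apply hA hm.aemeasurable,
        Measure.bind_apply hA hm.aemeasurable]
      exact lintegral_le_of_measure_le ih.2 _

lemma lawAt_bounds_uniformLaw {v : ℝ} (hv : 0 ≤ v) (hv' : v ≤ √2) {μ₀ : Measure Plane}
    (h : μ₀ = uniformLaw ∨ μ₀ = stationaryLaw v) (t : ℕ) :
    lawAt v μ₀ t ≤ (1024 : ℝ≥0∞) • uniformLaw ∧ uniformLaw ≤ (1024 : ℝ≥0∞) • lawAt v μ₀ t := by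
  have hs := stationaryLaw_bounds hv hv'
  have h0 : stationaryLaw v ≤ (32 : ℝ≥0∞) • stationaryLaw v := by
    refine Measure.le_intro fun A _ _ => ?_
    rw [Measure.smul_apply, smul_eq_mul]
    exact le_mul_of_one_le_left' (by norm_num)
  have key : lawAt v μ₀ t ≤ (32 : ℝ≥0∞) • stationaryLaw v ∧
      stationaryLaw v ≤ (32 : ℝ≥0∞) • lawAt v μ₀ t := by
    rcases h with rfl | rfl
    · exact lawAt_bounds hs.2 hs.1 t
    · exact lawAt_bounds h0 h0 t
  have comp : ∀ {μ ν ξ : Measure Plane}, μ ≤ (32 : ℝ≥0∞) • ν → ν ≤ (32 : ℝ≥0∞) • ξ →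
      μ ≤ (1024 : ℝ≥0∞) • ξ := by
    intro μ ν ξ h1 h2 A
    have h1 := h1 A
    have h2 := h2 A
    simp only [Measure.smul_apply, smul_eq_mul] at h1 h2 ⊢
    calc μ A ≤ 32 * (32 * ξ A) := h1.trans (by gcongr)
      _ = _ := by rw [← mul_assoc]; norm_num
  exact ⟨comp key.1 hs.1, comp hs.2 key.2⟩

lemma lawAt_compl_square {v : ℝ} (hv : 0 ≤ v) (hv' : v ≤ √2) {μ₀ : Measure Plane}
    (h : μ₀ = uniformLaw ∨ μ₀ = stationaryLaw v) (t : ℕ) : lawAt v μ₀ t squareᶜ = 0 := by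
  have h1 := (lawAt_bounds_uniformLaw hv hv' h t).1 squareᶜ
  simpa [uniformLaw_apply] using h1

lemma isProbabilityMeasure_lawAt {v : ℝ} (hv : 0 ≤ v) (hv' : v ≤ √2) {μ₀ : Measure Plane}
    (h : μ₀ = uniformLaw ∨ μ₀ = stationaryLaw v) (t : ℕ) :
    IsProbabilityMeasure (lawAt v μ₀ t) := by
  induction t with
  | zero =>
    rcases h with rfl | rfl
    · exact inferInstanceAs (IsProbabilityMeasure uniformLaw)
    · exact isProbabilityMeasure_stationaryLaw hv
  | succ t ih =>
    refine ⟨?_⟩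
    rw [lawAt, Measure.bind_apply MeasurableSet.univ (moveKernel v).measurable.aemeasurable]
    have hae : ∀ᵐ x ∂(lawAt v μ₀ t), moveKernel v x Set.univ = 1 := by
      have : ∀ᵐ x ∂(lawAt v μ₀ t), x ∈ square := lawAt_compl_square hv hv' h t
      filter_upwards [this] with x hx
      exact (isProbabilityMeasure_moveKernel hv hv' hx).measure_univ
    rw [lintegral_congr_ae hae]
    simp

/-! ### Contacts after one move -/

section ProductLaws

variable {ι : Type*} [Fintype ι] {μ : ι → Measure Plane} [∀ i, IsProbabilityMeasure (μ i)]

lemma map_pair_pi {i j : ι} (hij : i ≠ j) :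
    (Measure.pi μ).map (fun y => (y i, y j)) = (μ i).prod (μ j) := by
  have hind : iIndepFun (fun i (y : ι → Plane) => y i) (Measure.pi μ) :=
    iIndepFun_pi (X := fun _ => id) fun i => aemeasurable_id
  rw [((hind.indepFun hij).map_prod_eq_prod_map_map (measurable_pi_apply i).aemeasurable
    (measurable_pi_apply j).aemeasurable),
    (measurePreserving_eval μ i).map_eq, (measurePreserving_eval μ j).map_eq]

lemma map_triple_pi {i j k : ι} (hij : i ≠ j) (hik : i ≠ k) (hjk : j ≠ k) :
    (Measure.pi μ).map (fun y => ((y i, y j), y k)) = ((μ i).prod (μ j)).prod (μ k) := by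
  have hind : iIndepFun (fun i (y : ι → Plane) => y i) (Measure.pi μ) :=
    iIndepFun_pi (X := fun _ => id) fun i => aemeasurable_id
  rw [((hind.indepFun_prodMk (fun i => measurable_pi_apply i) i j k hik
    hjk).map_prod_eq_prod_map_map (by fun_prop) (measurable_pi_apply k).aemeasurable),
    map_pair_pi hij, (measurePreserving_eval μ k).map_eq]

end ProductLaws

section Contacts

variable {n : ℕ} {v r : ℝ} {x : Fin n → Plane}

/-- The event that nodes `i` and `j` are within distance `r` of each other. -/
def nearEvent (n : ℕ) (r : ℝ) (i j : Fin n) : Set (Fin n → Plane) := {y | dist (y i) (y j) ≤ r}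

lemma measurableSet_nearEvent (r : ℝ) (i j : Fin n) : MeasurableSet (nearEvent n r i j) :=
  measurableSet_le ((measurable_pi_apply i).dist (measurable_pi_apply j)) measurable_const

lemma transition_nearEvent (hv : 0 ≤ v) (hv' : v ≤ √2) (hx : ∀ i, x i ∈ square)
    {i j : Fin n} (hij : i ≠ j) :
    transition v x (nearEvent n r i j) =
      ((moveKernel v (x i)).prod (moveKernel v (x j))) {p | dist p.1 p.2 ≤ r} := by
  have := fun i => isProbabilityMeasure_moveKernel hv hv' (hx i)
  rw [transition, ← map_pair_pi (μ := fun i => moveKernel v (x i)) hij,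
    Measure.map_apply (by fun_prop) (measurableSet_dist_le r)]
  rfl

lemma isProbabilityMeasure_transition (hv : 0 ≤ v) (hv' : v ≤ √2) (hx : ∀ i, x i ∈ square) :
    IsProbabilityMeasure (transition v x) := by
  have := fun i => isProbabilityMeasure_moveKernel hv hv' (hx i)
  unfold transition
  infer_instance

lemma transition_nearEvent_le (hv : 0 ≤ v) (hv' : v ≤ √2) (hr : 0 < r)
    (hx : ∀ i, x i ∈ square) {i j : Fin n} (hij : i ≠ j) :
    (transition v x).real (nearEvent n r i j) ≤ 32 * contactRatio v r := by
  rw [measureReal_def, transition_nearEvent hv hv' hx hij]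
  exact ENNReal.toReal_le_of_le_ofReal (by have := contactRatio_nonneg v r; positivity)
    (prod_moveKernel_dist_le_le hv hv' hr (hx i) (hx j))

lemma le_transition_nearEvent (hv : 0 ≤ v) (hv' : v ≤ √2) (hr : 0 < r) (hr' : r ≤ √2)
    (hx : ∀ i, x i ∈ square) {i j : Fin n} (hij : i ≠ j)
    (h : dist (x i) (x j) ≤ max v r / 16) :
    contactRatio v r / 65536 ≤ (transition v x).real (nearEvent n r i j) := by
  have := isProbabilityMeasure_transition hv hv' hx
  refine (ENNReal.ofReal_le_iff_le_toReal (measure_ne_top _ _)).1 ?_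
  rw [transition_nearEvent hv hv' hx hij]
  exact le_prod_moveKernel_dist_le hv hv' hr hr' (hx i) (hx j) h

lemma transition_nearEvent_eq_zero (hv : 0 ≤ v) (hv' : v ≤ √2)
    (hx : ∀ i, x i ∈ square) {i j : Fin n} (hij : i ≠ j)
    (h : 3 * max v r < dist (x i) (x j)) :
    transition v x (nearEvent n r i j) = 0 := by
  rw [transition_nearEvent hv hv' hx hij]
  exact prod_moveKernel_dist_le_eq_zero hv hv' (hx i) (hx j) h

/-- Whatever the positions of `i` and `j` after the move, the independent node `k` is a neighbour
of `i` with probability at most of the order `contactRatio v r`. -/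
lemma transition_nearEvent_inter_le (hv : 0 ≤ v) (hv' : v ≤ √2) (hr : 0 < r)
    (hx : ∀ i, x i ∈ square) {i j k : Fin n} (hij : i ≠ j) (hik : i ≠ k) (hjk : j ≠ k) :
    (transition v x).real (nearEvent n r i j ∩ nearEvent n r i k)
      ≤ (transition v x).real (nearEvent n r i j) * (32 * contactRatio v r) := by
  have := fun i => isProbabilityMeasure_moveKernel hv hv' (hx i)
  have := isProbabilityMeasure_transition hv hv' hx
  have hm : MeasurableSet {p : (Plane × Plane) × Plane |
      dist p.1.1 p.1.2 ≤ r ∧ dist p.1.1 p.2 ≤ r} := by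
    rw [Set.ofPred_and]
    exact (measurableSet_le (by fun_prop) (by fun_prop)).inter
      (measurableSet_le (by fun_prop) (by fun_prop))
  have hm1 : MeasurableSet {q : Plane × Plane | dist q.1 q.2 ≤ r} := measurableSet_dist_le r
  have h : transition v x (nearEvent n r i j ∩ nearEvent n r i k)
      ≤ transition v x (nearEvent n r i j) * ENNReal.ofReal (32 * contactRatio v r) := by
    calc transition v x (nearEvent n r i j ∩ nearEvent n r i k)
        = (((moveKernel v (x i)).prod (moveKernel v (x j))).prod (moveKernel v (x k)))
            {p | dist p.1.1 p.1.2 ≤ r ∧ dist p.1.1 p.2 ≤ r} := by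
          rw [transition, ← map_triple_pi (μ := fun i => moveKernel v (x i)) hij hik hjk,
            Measure.map_apply (by fun_prop) hm]
          rfl
      _ ≤ ∫⁻ q, {q : Plane × Plane | dist q.1 q.2 ≤ r}.indicator
            (fun _ => ENNReal.ofReal (32 * contactRatio v r)) q
              ∂((moveKernel v (x i)).prod (moveKernel v (x j))) := by
          rw [Measure.prod_apply hm]
          refine lintegral_mono fun q => ?_
          by_cases hq : dist q.1 q.2 ≤ r
          · rw [Set.indicator_of_mem (by exact hq)]
            refine (measure_mono fun z hz => ?_).trans
              (moveKernel_closedBall_le hv hv' hr (hx k) q.1)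
            have hz2 : dist q.1 z ≤ r := hz.2
            rwa [Metric.mem_closedBall, dist_comm]
          · have : Prod.mk q ⁻¹' {p : (Plane × Plane) × Plane |
                dist p.1.1 p.1.2 ≤ r ∧ dist p.1.1 p.2 ≤ r} = ∅ := by
              ext z; simp [hq]
            simp [this]
      _ = _ := by
          rw [lintegral_indicator_const hm1, transition_nearEvent hv hv' hx hij, mul_comm]
  rw [measureReal_def, measureReal_def]
  calc _ ≤ (transition v x (nearEvent n r i j) *
        ENNReal.ofReal (32 * contactRatio v r)).toReal :=
        ENNReal.toReal_mono (ENNReal.mul_ne_top (measure_ne_top _ _) ENNReal.ofReal_ne_top) h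
    _ = _ := by
        rw [ENNReal.toReal_mul, ENNReal.toReal_ofReal]
        have := contactRatio_nonneg v r
        positivity

lemma mem_nbrs {y : Fin n → Plane} {i j : Fin n} :
    j ∈ nbrs r y i ↔ j ≠ i ∧ y ∈ nearEvent n r i j := by
  simp [nbrs, nearEvent]

lemma card_nbrs (y : Fin n → Plane) (i : Fin n) :
    ((nbrs r y i).card : ℝ) = ∑ k ∈ Finset.univ.erase i, (nearEvent n r i k).indicator 1 y := by
  classical
  simp only [Set.indicator_apply, Pi.one_apply, Finset.sum_boole]
  congr 2
  ext k
  simp [mem_nbrs]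

lemma measurable_card_nbrs (i : Fin n) :
    Measurable fun y : Fin n → Plane => ((nbrs r y i).card : ℝ) := by
  simp only [card_nbrs]
  exact Finset.measurable_sum _ fun k _ =>
    (measurable_one (α := ℝ)).indicator (measurableSet_nearEvent r i k)

lemma contactProb_eq_indicator {i j : Fin n} (hij : i ≠ j) (y : Fin n → Plane) :
    contactProb r y i j =
      (nearEvent n r i j).indicator (fun y => 1 / ((nbrs r y i).card : ℝ)) y := by
  classical
  simp [contactProb, mem_nbrs, hij.symm, Set.indicator_apply]

lemma contactProb_nonneg (y : Fin n → Plane) (i j : Fin n) : 0 ≤ contactProb r y i j := by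
  unfold contactProb; split_ifs <;> positivity

lemma contactProb_le_one (y : Fin n → Plane) (i j : Fin n) : contactProb r y i j ≤ 1 := by
  unfold contactProb
  split_ifs with h
  · rw [div_le_one (by exact_mod_cast Finset.card_pos.2 ⟨j, h⟩)]
    exact_mod_cast Finset.card_pos.2 ⟨j, h⟩
  · norm_num

/-- A node contacts at most one other node. -/
lemma sum_contactProb_le_one (y : Fin n → Plane) (i : Fin n) (T : Finset (Fin n)) :
    ∑ j ∈ T, contactProb r y i j ≤ 1 := by
  classical
  calc ∑ j ∈ T, contactProb r y i j ≤ ∑ j, contactProb r y i j :=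
        Finset.sum_le_sum_of_subset_of_nonneg (Finset.subset_univ T)
          fun j _ _ => contactProb_nonneg y i j
    _ ≤ 1 := by
        simp only [contactProb, Finset.sum_ite_mem, Finset.univ_inter, Finset.sum_const,
          nsmul_eq_mul, mul_one_div]
        exact div_self_le_one _

lemma integrable_contactProb (hv : 0 ≤ v) (hv' : v ≤ √2) (hx : ∀ i, x i ∈ square)
    {i j : Fin n} (hij : i ≠ j) :
    Integrable (fun y => contactProb r y i j) (transition v x) := by
  have := isProbabilityMeasure_transition hv hv' hx
  refine Integrable.of_bound (C := 1) ?_ (ae_of_all _ fun y => ?_)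
  · simp only [contactProb_eq_indicator hij]
    exact (((measurable_card_nbrs i).const_div 1).indicator
      (measurableSet_nearEvent r i j)).aestronglyMeasurable
  · rw [Real.norm_eq_abs, abs_of_nonneg (contactProb_nonneg y i j)]
    exact contactProb_le_one y i j

lemma integrable_indicator_nearEvent (hv : 0 ≤ v) (hv' : v ≤ √2) (hx : ∀ i, x i ∈ square)
    (i j : Fin n) :
    Integrable ((nearEvent n r i j).indicator (1 : (Fin n → Plane) → ℝ)) (transition v x) := by
  have := isProbabilityMeasure_transition hv hv' hx
  exact (integrable_const (1 : ℝ)).indicator (measurableSet_nearEvent r i j)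

/-- The expected contact probability is at least the probability of being neighbours divided by a
bound `W` of the expected number of neighbours of `i`, conditionally on `j` being one of them.
The pointwise inequality `1 / D ≥ 2 / W - D / W ^ 2` for the number `D` of neighbours makes the
expectation linear in `D`. -/
lemma le_integral_contactProb (hv : 0 ≤ v) (hv' : v ≤ √2) (hr : 0 < r)
    (hx : ∀ i, x i ∈ square) {i j : Fin n} (hij : i ≠ j) {W : ℝ}
    (hW : 1 + 32 * contactRatio v r *
      ((Finset.univ.filter fun k => dist (x i) (x k) ≤ 3 * max v r).card : ℝ) ≤ W) :
    (transition v x).real (nearEvent n r i j) / W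
      ≤ ∫ y, contactProb r y i j ∂(transition v x) := by
  classical
  have := isProbabilityMeasure_transition hv hv' hx
  have hρ := contactRatio_nonneg v r
  set p := (transition v x).real (nearEvent n r i j) with hp
  have hp0 : 0 ≤ p := measureReal_nonneg
  have hWpos : 0 < W := lt_of_lt_of_le (by positivity) hW
  have hpoint : ∀ y, 2 / W * (nearEvent n r i j).indicator 1 y -
      (1 / W ^ 2) * ∑ k ∈ Finset.univ.erase i,
        (nearEvent n r i j ∩ nearEvent n r i k).indicator 1 y ≤ contactProb r y i j := by
    intro y
    rw [contactProb_eq_indicator hij]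
    by_cases hy : y ∈ nearEvent n r i j
    · have hcard : ((nbrs r y i).card : ℝ) = ∑ k ∈ Finset.univ.erase i,
          (nearEvent n r i j ∩ nearEvent n r i k).indicator 1 y := by
        rw [card_nbrs]
        refine Finset.sum_congr rfl fun k _ => ?_
        simp [Set.indicator_apply, hy]
      have hD : (0 : ℝ) < (nbrs r y i).card := by
        exact_mod_cast Finset.card_pos.2 ⟨j, mem_nbrs.2 ⟨hij.symm, hy⟩⟩
      rw [Set.indicator_of_mem hy, Set.indicator_of_mem hy, ← hcard, Pi.one_apply]
      set D : ℝ := ((nbrs r y i).card : ℝ)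
      have : 1 / D - (2 / W * 1 - 1 / W ^ 2 * D) = (W - D) ^ 2 / (D * W ^ 2) := by
        field_simp; ring
      have h2 : 0 ≤ (W - D) ^ 2 / (D * W ^ 2) := by positivity
      linarith
    · rw [Set.indicator_of_notMem hy, Set.indicator_of_notMem hy,
        Finset.sum_eq_zero fun k _ => Set.indicator_of_notMem (fun h => hy h.1) _]
      simp
  have hint : ∀ A : Set (Fin n → Plane), MeasurableSet A →
      Integrable (A.indicator (1 : (Fin n → Plane) → ℝ)) (transition v x) :=
    fun A hA => (integrable_const (1 : ℝ)).indicator hA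
  have hmA := measurableSet_nearEvent (n := n) r i j
  have hmB := fun k => hmA.inter (measurableSet_nearEvent (n := n) r i k)
  have hsum : ∑ k ∈ Finset.univ.erase i,
      (transition v x).real (nearEvent n r i j ∩ nearEvent n r i k) ≤ p * W := by
    have hterm : ∀ k ∈ Finset.univ.erase i,
        (transition v x).real (nearEvent n r i j ∩ nearEvent n r i k) ≤
          (if k = j then p else 0) + (if dist (x i) (x k) ≤ 3 * max v r then
            p * (32 * contactRatio v r) else 0) := by
      intro k hk
      have hki : i ≠ k := (Finset.ne_of_mem_erase hk).symm
      have h3 : 0 ≤ (if dist (x i) (x k) ≤ 3 * max v r then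
            p * (32 * contactRatio v r) else 0) := by split_ifs <;> positivity
      by_cases hkj : k = j
      · subst hkj
        rw [Set.inter_self, if_pos rfl]
        linarith
      · rw [if_neg hkj, zero_add]
        split_ifs with hd
        · exact transition_nearEvent_inter_le hv hv' hr hx hij hki (Ne.symm hkj)
        · refine le_of_eq ?_
          rw [measureReal_def, measure_mono_null Set.inter_subset_right
            (transition_nearEvent_eq_zero hv hv' hx hki (not_le.1 hd))]
          simp
    calc _ ≤ ∑ k ∈ Finset.univ.erase i, ((if k = j then p else 0) +
            (if dist (x i) (x k) ≤ 3 * max v r then p * (32 * contactRatio v r) else 0)) :=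
          Finset.sum_le_sum hterm
      _ ≤ ∑ k, ((if k = j then p else 0) +
            (if dist (x i) (x k) ≤ 3 * max v r then p * (32 * contactRatio v r) else 0)) := by
          refine Finset.sum_le_sum_of_subset_of_nonneg (Finset.erase_subset _ _) fun k _ _ => ?_
          split_ifs <;> positivity
      _ = p * (1 + 32 * contactRatio v r *
            ((Finset.univ.filter fun k => dist (x i) (x k) ≤ 3 * max v r).card : ℝ)) := by
          rw [Finset.sum_add_distrib, Finset.sum_ite_eq' Finset.univ j, ← Finset.sum_filter,
            Finset.sum_const, nsmul_eq_mul]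
          simp only [Finset.mem_univ, if_true]
          ring
      _ ≤ p * W := by gcongr
  calc p / W = 2 / W * p - 1 / W ^ 2 * (p * W) := by field_simp; ring
    _ ≤ 2 / W * p - 1 / W ^ 2 * ∑ k ∈ Finset.univ.erase i,
          (transition v x).real (nearEvent n r i j ∩ nearEvent n r i k) := by gcongr
    _ = ∫ y, (2 / W * (nearEvent n r i j).indicator 1 y -
          (1 / W ^ 2) * ∑ k ∈ Finset.univ.erase i,
            (nearEvent n r i j ∩ nearEvent n r i k).indicator 1 y) ∂(transition v x) := by
        rw [integral_sub ((hint _ hmA).const_mul _)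
          ((integrable_finsetSum _ fun k _ => hint _ (hmB k)).const_mul _),
          integral_const_mul, integral_const_mul,
          integral_finsetSum _ fun k _ => hint _ (hmB k), integral_indicator_one hmA]
        simp only [integral_indicator_one (hmB _)]
        rw [hp]
    _ ≤ _ := integral_mono (((hint _ hmA).const_mul _).sub
        ((integrable_finsetSum _ fun k _ => hint _ (hmB k)).const_mul _))
          (integrable_contactProb hv hv' hx hij) hpoint

lemma integral_crossEdges (hv : 0 ≤ v) (hv' : v ≤ √2) (hx : ∀ i, x i ∈ square)
    (S : Finset (Fin n)) :
    ∫ y, crossEdges r y S ∂(transition v x) =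
      ∑ i ∈ S, ∑ j ∈ Sᶜ, (transition v x).real (nearEvent n r i j) := by
  classical
  have heq : ∀ y, crossEdges r y S =
      ∑ i ∈ S, ∑ j ∈ Sᶜ, (nearEvent n r i j).indicator 1 y := by
    intro y
    refine Finset.sum_congr rfl fun i hi => Finset.sum_congr rfl fun j hj => ?_
    have : j ≠ i := fun h => Finset.mem_compl.1 hj (h ▸ hi)
    simp [mem_nbrs, this, Set.indicator_apply]
  simp only [heq]
  rw [integral_finsetSum _ fun i _ => integrable_finsetSum _ fun j _ =>
    integrable_indicator_nearEvent hv hv' hx i j]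
  refine Finset.sum_congr rfl fun i _ => ?_
  rw [integral_finsetSum _ fun j _ => integrable_indicator_nearEvent hv hv' hx i j]
  exact Finset.sum_congr rfl fun j _ => integral_indicator_one (measurableSet_nearEvent r i j)

lemma integral_sum_contactProb (hv : 0 ≤ v) (hv' : v ≤ √2) (hx : ∀ i, x i ∈ square)
    (S : Finset (Fin n)) :
    ∫ y, (∑ i ∈ S, ∑ j ∈ Sᶜ, contactProb r y i j) / (S.card : ℝ) ∂(transition v x) =
      (∑ i ∈ S, ∑ j ∈ Sᶜ, ∫ y, contactProb r y i j ∂(transition v x)) / (S.card : ℝ) := by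
  classical
  have hne : ∀ i ∈ S, ∀ j ∈ Sᶜ, i ≠ j := fun i hi j hj h => Finset.mem_compl.1 hj (h ▸ hi)
  have hint : ∀ i ∈ S, ∀ j ∈ Sᶜ, Integrable (fun y => contactProb r y i j) (transition v x) :=
    fun i hi j hj => integrable_contactProb hv hv' hx (hne i hi j hj)
  rw [integral_div, integral_finsetSum _ fun i hi => integrable_finsetSum _ (hint i hi)]
  congr 1
  exact Finset.sum_congr rfl fun i hi => integral_finsetSum _ (hint i hi)

end Contacts

/-! ### Edge expansion of a balanced grid -/

/-- The probability that two independent bits, equal to one with probabilities `p` and `q`,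
differ. As a function of `(p, q)` it satisfies the triangle inequality, although it does not vanish
on the diagonal. -/
def bitDiff (p q : ℝ) : ℝ := p * (1 - q) + q * (1 - p)

lemma bitDiff_nonneg {p q : ℝ} (hp : p ∈ Set.Icc (0 : ℝ) 1) (hq : q ∈ Set.Icc (0 : ℝ) 1) :
    0 ≤ bitDiff p q :=
  add_nonneg (mul_nonneg hp.1 (sub_nonneg.2 hq.2)) (mul_nonneg hq.1 (sub_nonneg.2 hp.2))

lemma bitDiff_comm (p q : ℝ) : bitDiff p q = bitDiff q p := add_comm _ _

lemma bitDiff_triangle {p q s : ℝ} (hp : p ∈ Set.Icc (0 : ℝ) 1) (hq : q ∈ Set.Icc (0 : ℝ) 1)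
    (hs : s ∈ Set.Icc (0 : ℝ) 1) : bitDiff p s ≤ bitDiff p q + bitDiff q s := by
  obtain ⟨hp0, hp1⟩ := hp
  obtain ⟨hq0, hq1⟩ := hq
  obtain ⟨hs0, hs1⟩ := hs
  have h1 := mul_nonneg (mul_nonneg hq0 (sub_nonneg.2 hp1)) (sub_nonneg.2 hs1)
  have h2 := mul_nonneg (mul_nonneg (sub_nonneg.2 hq1) hp0) hs0
  -- the two bits `p`, `s` agree and differ from `q`: this event is counted twice on the right
  have : bitDiff p q + bitDiff q s - bitDiff p s
      = 2 * (q * (1 - p) * (1 - s)) + 2 * ((1 - q) * p * s) := by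
    unfold bitDiff; ring
  linarith

lemma bitDiff_le_sum_Ico {p : ℕ → ℝ} (hp : ∀ k, p k ∈ Set.Icc (0 : ℝ) 1) {a b : ℕ} (hab : a < b) :
    bitDiff (p a) (p b) ≤ ∑ k ∈ Finset.Ico a b, bitDiff (p k) (p (k + 1)) := by
  induction b, hab using Nat.le_induction with
  | base => simp
  | succ b hab ih =>
    rw [Finset.sum_Ico_succ_top (by omega)]
    exact (bitDiff_triangle (hp a) (hp b) (hp (b + 1))).trans (by gcongr)

/-- The total `bitDiff` over the loops and the edges of the path `0, …, K - 1`. -/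
noncomputable def lineVariation (K : ℕ) (p : ℕ → ℝ) : ℝ :=
  ∑ k ∈ Finset.range K, bitDiff (p k) (p k) +
    ∑ k ∈ Finset.range (K - 1), bitDiff (p k) (p (k + 1))

lemma bitDiff_le_lineVariation {p : ℕ → ℝ} (hp : ∀ k, p k ∈ Set.Icc (0 : ℝ) 1) {K a b : ℕ}
    (ha : a < K) (hb : b < K) : bitDiff (p a) (p b) ≤ lineVariation K p := by
  have h0 : ∀ j k, 0 ≤ bitDiff (p j) (p k) := fun j k => bitDiff_nonneg (hp j) (hp k)
  have hs1 : 0 ≤ ∑ k ∈ Finset.range K, bitDiff (p k) (p k) :=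
    Finset.sum_nonneg fun k _ => h0 _ _
  have hs2 : 0 ≤ ∑ k ∈ Finset.range (K - 1), bitDiff (p k) (p (k + 1)) :=
    Finset.sum_nonneg fun k _ => h0 _ _
  have key : ∀ {a b : ℕ}, a < b → b < K → bitDiff (p a) (p b) ≤ lineVariation K p := by
    intro a b hab hb
    have h1 := bitDiff_le_sum_Ico hp hab
    have h2 : ∑ k ∈ Finset.Ico a b, bitDiff (p k) (p (k + 1)) ≤
        ∑ k ∈ Finset.range (K - 1), bitDiff (p k) (p (k + 1)) := by
      refine Finset.sum_le_sum_of_subset_of_nonneg (fun k hk => ?_) fun k _ _ => h0 _ _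
      simp only [Finset.mem_Ico, Finset.mem_range] at hk ⊢
      omega
    unfold lineVariation
    linarith
  rcases lt_trichotomy a b with h | rfl | h
  · exact key h hb
  · have := Finset.single_le_sum (f := fun k => bitDiff (p k) (p k)) (fun k _ => h0 k k)
      (Finset.mem_range.2 ha)
    unfold lineVariation
    linarith
  · rw [bitDiff_comm]
    exact key h ha

/-- A Poincaré inequality of `L¹` type on the grid: every pair of cells is joined by a path of one
horizontal and one vertical segment, and each row and column is used by `K ^ 3` pairs. -/
lemma sum_bitDiff_le {f : ℕ → ℕ → ℝ} (hf : ∀ a b, f a b ∈ Set.Icc (0 : ℝ) 1) (K : ℕ) :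
    ∑ a ∈ Finset.range K, ∑ b ∈ Finset.range K, ∑ a' ∈ Finset.range K, ∑ b' ∈ Finset.range K,
        bitDiff (f a b) (f a' b')
      ≤ (K : ℝ) ^ 3 * (∑ b ∈ Finset.range K, lineVariation K (fun a => f a b) +
          ∑ a ∈ Finset.range K, lineVariation K (f a)) := by
  calc _ ≤ ∑ a ∈ Finset.range K, ∑ b ∈ Finset.range K, ∑ a' ∈ Finset.range K,
          ∑ b' ∈ Finset.range K, (lineVariation K (fun a => f a b) + lineVariation K (f a')) := by
        refine Finset.sum_le_sum fun a ha => Finset.sum_le_sum fun b hb =>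
          Finset.sum_le_sum fun a' ha' => Finset.sum_le_sum fun b' hb' => ?_
        rw [Finset.mem_range] at ha hb ha' hb'
        exact (bitDiff_triangle (hf a b) (hf a' b) (hf a' b')).trans
          (add_le_add (bitDiff_le_lineVariation (fun k => hf k b) ha ha')
            (bitDiff_le_lineVariation (hf a') hb hb'))
    _ = _ := by
        simp only [Finset.sum_add_distrib, Finset.sum_const, Finset.card_range, nsmul_eq_mul,
          ← Finset.mul_sum]
        ring

/-- Two cells of the grid are equal or have a common side or corner. -/
def Touching (c c' : ℕ × ℕ) : Prop :=
  (c.1 ≤ c'.1 + 1 ∧ c'.1 ≤ c.1 + 1) ∧ (c.2 ≤ c'.2 + 1 ∧ c'.2 ≤ c.2 + 1)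

instance (c c' : ℕ × ℕ) : Decidable (Touching c c') := by unfold Touching; infer_instance

/-- The cells of the `K × K` grid. -/
def grid (K : ℕ) : Finset (ℕ × ℕ) := Finset.range K ×ˢ Finset.range K

section Expansion

variable {ι : Type*} [Fintype ι] [DecidableEq ι]

/-- The number of pairs of an element of `S` in the cell `c` and an element of the complement of
`S` in the cell `c'`. -/
noncomputable def crossPairs (g : ι → ℕ × ℕ) (S : Finset ι) (c c' : ℕ × ℕ) : ℝ :=
  ((S.filter fun i => g i = c).card : ℝ) * ((Sᶜ.filter fun i => g i = c').card : ℝ)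

/-- The number of pairs of an element of `S` and an element of its complement in touching cells. -/
noncomputable def touchingPairs (g : ι → ℕ × ℕ) (S : Finset ι) : ℝ :=
  ∑ i ∈ S, ∑ j ∈ Sᶜ, if Touching (g i) (g j) then 1 else 0

lemma crossPairs_eq_sum (g : ι → ℕ × ℕ) (S : Finset ι) (c c' : ℕ × ℕ) :
    crossPairs g S c c' = ∑ i ∈ S, ∑ j ∈ Sᶜ, if g i = c ∧ g j = c' then 1 else 0 := by
  rw [crossPairs, ← Finset.sum_boole, ← Finset.sum_boole, Finset.sum_mul_sum]
  refine Finset.sum_congr rfl fun i _ => Finset.sum_congr rfl fun j _ => ?_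
  split_ifs <;> simp_all

/-- The pairs across the cut are counted without repetition along a family of distinct pairs of
touching cells. -/
lemma sum_crossPairs_le (g : ι → ℕ × ℕ) (S : Finset ι) {κ : Type*} (F : Finset κ)
    (α β : κ → ℕ × ℕ) (hinj : Function.Injective fun k => (α k, β k))
    (ht : ∀ k, Touching (α k) (β k)) :
    ∑ k ∈ F, crossPairs g S (α k) (β k) ≤ touchingPairs g S := by
  simp only [crossPairs_eq_sum]
  rw [Finset.sum_comm]
  refine Finset.sum_le_sum fun i _ => ?_
  rw [Finset.sum_comm]
  refine Finset.sum_le_sum fun j _ => ?_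
  rw [Finset.sum_boole]
  split_ifs with h
  · have : (F.filter fun k => g i = α k ∧ g j = β k).card ≤ 1 := by
      refine Finset.card_le_one.2 fun k hk k' hk' => hinj ?_
      simp only [Finset.mem_filter] at hk hk'
      simp [← hk.2.1, ← hk.2.2, ← hk'.2.1, ← hk'.2.2]
    exact_mod_cast this
  · refine le_of_eq ?_
    rw [Nat.cast_eq_zero, Finset.card_eq_zero, Finset.filter_eq_empty_iff]
    rintro k _ ⟨h1, h2⟩
    exact h (h1 ▸ h2 ▸ ht k)

lemma card_filter_add_card_compl_filter (g : ι → ℕ × ℕ) (S : Finset ι) (c : ℕ × ℕ) :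
    ((S.filter fun i => g i = c).card : ℝ) + ((Sᶜ.filter fun i => g i = c).card : ℝ)
      = ((Finset.univ.filter fun i => g i = c).card : ℝ) := by
  rw [← Finset.union_compl S, Finset.filter_union, Finset.card_union_of_disjoint]
  · push_cast; rfl
  · exact Finset.disjoint_filter_filter disjoint_compl_right

/-- Edge expansion of the graph whose vertices are in the cells of a `K × K` grid, with between `l`
and `u` vertices per cell, and whose edges join the vertices in touching cells. -/
theorem card_mul_card_compl_le_touchingPairs (g : ι → ℕ × ℕ) (S : Finset ι) {K : ℕ} {l u : ℝ}
    (hl : 0 < l) (hg : ∀ i, g i ∈ grid K)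
    (hlow : ∀ c ∈ grid K, l ≤ ((Finset.univ.filter fun i => g i = c).card : ℝ))
    (hup : ∀ c ∈ grid K, ((Finset.univ.filter fun i => g i = c).card : ℝ) ≤ u) :
    l ^ 2 * ((S.card : ℝ) * (Sᶜ.card : ℝ)) ≤ 8 * u ^ 2 * (K : ℝ) ^ 3 * touchingPairs g S := by
  set N : ℕ × ℕ → ℝ := fun c => ((Finset.univ.filter fun i => g i = c).card : ℝ) with hN
  set A : ℕ × ℕ → ℝ := fun c => ((S.filter fun i => g i = c).card : ℝ) with hA
  set E := crossPairs g S with hE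
  set T := touchingPairs g S with hT
  have hAN : ∀ c, 0 ≤ A c ∧ A c ≤ N c := fun c => ⟨Nat.cast_nonneg _, by
    have := card_filter_add_card_compl_filter g S c
    have h2 : (0 : ℝ) ≤ ((Sᶜ.filter fun i => g i = c).card : ℝ) := Nat.cast_nonneg _
    simp only [hA, hN]; linarith⟩
  have hE0 : ∀ c c', 0 ≤ E c c' := fun c c' => by
    simp only [hE, crossPairs]; positivity
  set f : ℕ → ℕ → ℝ := fun a b => A (a, b) / N (a, b) with hf
  have hf01 : ∀ a b, f a b ∈ Set.Icc (0 : ℝ) 1 := fun a b =>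
    ⟨div_nonneg (hAN _).1 ((hAN _).1.trans (hAN _).2),
      div_le_one_of_le₀ (hAN _).2 ((hAN _).1.trans (hAN _).2)⟩
  have hED : ∀ c ∈ grid K, ∀ c' ∈ grid K,
      E c c' + E c' c = N c * N c' * bitDiff (f c.1 c.2) (f c'.1 c'.2) := by
    intro c hc c' hc'
    have hNc : N c ≠ 0 := (hl.trans_le (hlow c hc)).ne'
    have hNc' : N c' ≠ 0 := (hl.trans_le (hlow c' hc')).ne'
    have hB : ∀ c, ((Sᶜ.filter fun i => g i = c).card : ℝ) = N c - A c := fun c => by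
      have := card_filter_add_card_compl_filter g S c
      simp only [hA, hN]; linarith
    simp only [hE, crossPairs, hB, bitDiff, hf]
    field_simp
    ring
  have hupper : ∀ c ∈ grid K, ∀ c' ∈ grid K,
      E c c' ≤ u ^ 2 * bitDiff (f c.1 c.2) (f c'.1 c'.2) := by
    intro c hc c' hc'
    have h0 := bitDiff_nonneg (hf01 c.1 c.2) (hf01 c'.1 c'.2)
    calc E c c' ≤ N c * N c' * bitDiff (f c.1 c.2) (f c'.1 c'.2) := by
          rw [← hED c hc c' hc']; linarith [hE0 c' c]
      _ ≤ u * u * bitDiff (f c.1 c.2) (f c'.1 c'.2) := by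
          gcongr
          · exact hl.le.trans ((hlow c hc).trans (hup c hc))
          · exact hup c hc
          · exact hup c' hc'
      _ = _ := by ring
  have hlower : ∀ c ∈ grid K, ∀ c' ∈ grid K,
      l ^ 2 * bitDiff (f c.1 c.2) (f c'.1 c'.2) ≤ E c c' + E c' c := by
    intro c hc c' hc'
    rw [hED c hc c' hc', sq]
    have h0 := bitDiff_nonneg (hf01 c.1 c.2) (hf01 c'.1 c'.2)
    exact mul_le_mul_of_nonneg_right (mul_le_mul (hlow c hc) (hlow c' hc') hl.le
      ((hAN c).1.trans (hAN c).2)) h0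
  have htotal : ∑ c ∈ grid K, ∑ c' ∈ grid K, E c c' = (S.card : ℝ) * (Sᶜ.card : ℝ) := by
    simp only [hE, crossPairs, ← Finset.mul_sum, ← Finset.sum_mul]
    rw [Finset.card_eq_sum_card_fiberwise (s := S) (t := grid K) (f := g) fun i _ => hg i,
      Finset.card_eq_sum_card_fiberwise (s := Sᶜ) (t := grid K) (f := g) fun i _ => hg i]
    push_cast
    rfl
  -- loops and edges of all rows, or of all columns, in the parametrization `q` of the cells
  have hvar : ∀ q : ℕ × ℕ → ℕ × ℕ, Function.Injective q →
      (∀ b k, b < K → k < K → q (b, k) ∈ grid K) →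
      (∀ b k, Touching (q (b, k)) (q (b, k))) → (∀ b k, Touching (q (b, k)) (q (b, k + 1))) →
      (∀ b k, Touching (q (b, k + 1)) (q (b, k))) →
      l ^ 2 * ∑ b ∈ Finset.range K,
        lineVariation K (fun k => f (q (b, k)).1 (q (b, k)).2) ≤ 4 * T := by
    intro q hq hgrid t0 t1 t2
    have hshift : Function.Injective fun p : ℕ × ℕ => (p.1, p.2 + 1) := by
      rintro ⟨a, b⟩ ⟨a', b'⟩ h
      simpa using h
    have s0 := sum_crossPairs_le g S (grid K) q q
      (fun k k' h => hq (Prod.ext_iff.1 h).1) fun k => t0 k.1 k.2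
    have s1 := sum_crossPairs_le g S (Finset.range K ×ˢ Finset.range (K - 1)) q
      (fun p => q (p.1, p.2 + 1)) (fun k k' h => hq (Prod.ext_iff.1 h).1) fun k => t1 k.1 k.2
    have s2 := sum_crossPairs_le g S (Finset.range K ×ˢ Finset.range (K - 1))
      (fun p => q (p.1, p.2 + 1)) q (fun k k' h => hq (Prod.ext_iff.1 h).2) fun k => t2 k.1 k.2
    rw [grid, Finset.sum_product] at s0
    rw [Finset.sum_product] at s1 s2
    calc l ^ 2 * ∑ b ∈ Finset.range K, lineVariation K (fun k => f (q (b, k)).1 (q (b, k)).2)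
        ≤ ∑ b ∈ Finset.range K, (∑ k ∈ Finset.range K,
              (E (q (b, k)) (q (b, k)) + E (q (b, k)) (q (b, k))) +
            ∑ k ∈ Finset.range (K - 1),
              (E (q (b, k)) (q (b, k + 1)) + E (q (b, k + 1)) (q (b, k)))) := by
          rw [Finset.mul_sum]
          refine Finset.sum_le_sum fun b hb => ?_
          rw [lineVariation, mul_add, Finset.mul_sum, Finset.mul_sum]
          rw [Finset.mem_range] at hb
          refine add_le_add (Finset.sum_le_sum fun k hk => ?_) (Finset.sum_le_sum fun k hk => ?_)
          · rw [Finset.mem_range] at hk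
            exact hlower _ (hgrid b k hb hk) _ (hgrid b k hb hk)
          · rw [Finset.mem_range] at hk
            exact hlower _ (hgrid b k hb (by omega)) _ (hgrid b (k + 1) hb (by omega))
      _ ≤ 4 * T := by
          simp only [Finset.sum_add_distrib]
          linarith
  have hrows := hvar (fun p => (p.2, p.1)) (fun p p' h => by
      simp only [Prod.mk.injEq] at h; exact Prod.ext h.2 h.1)
    (fun b k hb hk => by simp [grid, hb, hk]) (fun b k => by simp [Touching])
    (fun b k => by simp [Touching]; omega) (fun b k => by simp [Touching]; omega)
  have hcols := hvar id Function.injective_id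
    (fun b k hb hk => by simp [grid, hb, hk]) (fun b k => by simp [Touching])
    (fun b k => by simp [Touching]; omega) (fun b k => by simp [Touching]; omega)
  have hpoin := sum_bitDiff_le hf01 K
  calc l ^ 2 * ((S.card : ℝ) * (Sᶜ.card : ℝ))
      = l ^ 2 * ∑ c ∈ grid K, ∑ c' ∈ grid K, E c c' := by rw [htotal]
    _ ≤ l ^ 2 * ∑ c ∈ grid K, ∑ c' ∈ grid K, u ^ 2 * bitDiff (f c.1 c.2) (f c'.1 c'.2) := by
        gcongr with c hc c' hc'
        exact hupper c hc c' hc'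
    _ = l ^ 2 * u ^ 2 * ∑ a ∈ Finset.range K, ∑ b ∈ Finset.range K, ∑ a' ∈ Finset.range K,
          ∑ b' ∈ Finset.range K, bitDiff (f a b) (f a' b') := by
        simp only [← Finset.mul_sum, grid, Finset.sum_product]
        ring
    _ ≤ l ^ 2 * u ^ 2 * ((K : ℝ) ^ 3 * (∑ b ∈ Finset.range K, lineVariation K (fun a => f a b) +
          ∑ a ∈ Finset.range K, lineVariation K (f a))) := by gcongr
    _ = u ^ 2 * (K : ℝ) ^ 3 * (l ^ 2 * ∑ b ∈ Finset.range K, lineVariation K (fun a => f a b) +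
          l ^ 2 * ∑ a ∈ Finset.range K, lineVariation K (f a)) := by ring
    _ ≤ u ^ 2 * (K : ℝ) ^ 3 * (4 * T + 4 * T) := by
        exact mul_le_mul_of_nonneg_left (add_le_add hrows hcols) (by positivity)
    _ = _ := by ring

end Expansion

lemma card_filter_mem_eq_sum {ι : Type*} [Fintype ι] (g : ι → ℕ × ℕ) (F : Finset (ℕ × ℕ)) :
    ((Finset.univ.filter fun i => g i ∈ F).card : ℝ)
      = ∑ c ∈ F, ((Finset.univ.filter fun i => g i = c).card : ℝ) := by
  rw [Finset.card_eq_sum_card_fiberwise (f := g) (t := F) (by intro i; simp), Nat.cast_sum]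
  refine Finset.sum_congr rfl fun c hc => ?_
  congr 2
  ext i
  simp only [Finset.mem_filter, Finset.mem_univ, true_and]
  exact ⟨fun h => h.2, fun h => ⟨h ▸ hc, h⟩⟩

lemma card_filter_mem_le {ι : Type*} [Fintype ι] (g : ι → ℕ × ℕ) {u : ℝ} (F : Finset (ℕ × ℕ))
    (hup : ∀ c ∈ F, ((Finset.univ.filter fun i => g i = c).card : ℝ) ≤ u) :
    ((Finset.univ.filter fun i => g i ∈ F).card : ℝ) ≤ u * F.card := by
  rw [card_filter_mem_eq_sum, mul_comm, ← nsmul_eq_mul]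
  exact Finset.sum_le_card_nsmul _ _ _ hup

lemma le_card_filter_mem {ι : Type*} [Fintype ι] (g : ι → ℕ × ℕ) {l : ℝ} (F : Finset (ℕ × ℕ))
    (hlow : ∀ c ∈ F, l ≤ ((Finset.univ.filter fun i => g i = c).card : ℝ)) :
    l * F.card ≤ ((Finset.univ.filter fun i => g i ∈ F).card : ℝ) := by
  rw [card_filter_mem_eq_sum, mul_comm, ← nsmul_eq_mul]
  exact Finset.card_nsmul_le_sum _ _ _ hlow

/-! ### The grid on the square -/

/-- The index of the interval `[a / K, (a + 1) / K]` containing `s`; the right end point of the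
unit interval is put into the last one. -/
noncomputable def cellCoord (K : ℕ) (s : ℝ) : ℕ := min ⌊(K : ℝ) * s⌋₊ (K - 1)

/-- The cell of the `K × K` grid on the unit square that contains a point. -/
noncomputable def cell (K : ℕ) (x : Plane) : ℕ × ℕ := (cellCoord K (x 0), cellCoord K (x 1))

lemma cellCoord_lt {K : ℕ} (hK : 0 < K) (s : ℝ) : cellCoord K s < K :=
  (min_le_right _ _).trans_lt (by omega)

lemma cell_mem_grid {K : ℕ} (hK : 0 < K) (x : Plane) : cell K x ∈ grid K := by
  simp [cell, grid, cellCoord_lt hK]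

lemma cellCoord_bounds {K : ℕ} (hK : 0 < K) {s : ℝ} (hs : s ∈ Set.Icc (0 : ℝ) 1) :
    (cellCoord K s : ℝ) ≤ K * s ∧ K * s ≤ cellCoord K s + 1 := by
  have hK' : (0 : ℝ) < K := by exact_mod_cast hK
  have h0 : 0 ≤ (K : ℝ) * s := mul_nonneg hK'.le hs.1
  refine ⟨?_, ?_⟩
  · exact le_trans (by exact_mod_cast min_le_left _ _) (Nat.floor_le h0)
  · rcases min_cases ⌊(K : ℝ) * s⌋₊ (K - 1) with h | h
    · rw [cellCoord, h.1]
      exact (Nat.lt_floor_add_one _).le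
    · rw [cellCoord, h.1, Nat.cast_sub hK, Nat.cast_one]
      nlinarith [hs.2]

lemma cellCoord_eq {K a : ℕ} {s : ℝ} (ha : a < K) (h₁ : (a : ℝ) < K * s) (h₂ : K * s < a + 1) :
    cellCoord K s = a := by
  have : ⌊(K : ℝ) * s⌋₊ = a :=
    (Nat.floor_eq_iff ((Nat.cast_nonneg a).trans h₁.le)).2 ⟨h₁.le, h₂⟩
  rw [cellCoord, this]
  omega

lemma measurable_cell (K : ℕ) : Measurable (cell K) := by
  have h : ∀ i : Fin 2, Measurable fun x : Plane => cellCoord K (x i) := fun i =>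
    (Nat.measurable_floor.comp ((by fun_prop : Measurable fun x : Plane => x i).const_mul
      (K : ℝ))).min measurable_const
  exact (h 0).prodMk (h 1)

lemma dist_le_of_touching {K : ℕ} (hK : 0 < K) {x y : Plane} (hx : x ∈ square) (hy : y ∈ square)
    (h : Touching (cell K x) (cell K y)) : dist x y ≤ 3 / K := by
  have hK' : (0 : ℝ) < K := by exact_mod_cast hK
  have key : ∀ i, cellCoord K (x i) ≤ cellCoord K (y i) + 1 →
      cellCoord K (y i) ≤ cellCoord K (x i) + 1 → |x i - y i| ≤ 2 / K := by
    intro i h1 h2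
    have h1 : (cellCoord K (x i) : ℝ) ≤ cellCoord K (y i) + 1 := by exact_mod_cast h1
    have h2 : (cellCoord K (y i) : ℝ) ≤ cellCoord K (x i) + 1 := by exact_mod_cast h2
    have bx := cellCoord_bounds hK (hx i)
    have bz := cellCoord_bounds hK (hy i)
    rw [le_div_iff₀ hK', ← abs_of_pos hK', ← abs_mul, abs_le]
    constructor <;> nlinarith
  refine dist_le_of_coord (s := 2 / K) (by positivity) ?_ fun i => ?_
  · rw [div_pow, div_pow, ← mul_div_assoc]
    gcongr
    norm_num
  · fin_cases i
    · exact key 0 h.1.1 h.1.2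
    · exact key 1 h.2.1 h.2.2

lemma cellCoord_le_of_dist_le {K m : ℕ} (hK : 0 < K) {x y : Plane} (hx : x ∈ square)
    (hy : y ∈ square) (h : K * dist x y ≤ m) (i : Fin 2) :
    cellCoord K (x i) ≤ cellCoord K (y i) + (m + 1) := by
  have hK' : (0 : ℝ) < K := by exact_mod_cast hK
  have h1 := (abs_le.1 (abs_coord_sub_le_dist x y i)).2
  have bx := cellCoord_bounds hK (hx i)
  have bz := cellCoord_bounds hK (hy i)
  have : (cellCoord K (x i) : ℝ) ≤ cellCoord K (y i) + (m + 1) := by nlinarith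
  exact_mod_cast this

lemma uniformLaw_cell {K : ℕ} (hK : 0 < K) {c : ℕ × ℕ} (hc : c ∈ grid K) :
    uniformLaw (cell K ⁻¹' {c}) = ENNReal.ofReal (1 / (K : ℝ) ^ 2) := by
  have hK' : (0 : ℝ) < K := by exact_mod_cast hK
  simp only [grid, Finset.mem_product, Finset.mem_range] at hc
  set a : Fin 2 → ℝ := ![(c.1 : ℝ) / K, (c.2 : ℝ) / K] with ha
  have hprod : ∏ i : Fin 2, ENNReal.ofReal (a i + 1 / K - a i)
      = ENNReal.ofReal (1 / (K : ℝ) ^ 2) := by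
    simp only [add_sub_cancel_left, Finset.prod_const, Finset.card_univ, Fintype.card_fin]
    rw [← ENNReal.ofReal_pow (by positivity)]
    congr 1; ring
  rw [uniformLaw_apply]
  apply le_antisymm
  · rw [← hprod, ← volume_Icc_box]
    refine measure_mono fun x hx i => ?_
    have hcell : cell K x = c := hx.2
    have hcc : ∀ i (k : ℕ), cellCoord K (x i) = k →
        x i ∈ Set.Icc ((k : ℝ) / K) (k / K + 1 / K) := by
      intro i k hk
      have := cellCoord_bounds hK (hx.1 i)
      rw [hk] at this
      rw [Set.mem_Icc, ← add_div, div_le_iff₀ hK', le_div_iff₀ hK']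
      constructor <;> linarith [this.1, this.2]
    fin_cases i
    · exact hcc 0 c.1 (by rw [← hcell]; rfl)
    · exact hcc 1 c.2 (by rw [← hcell]; rfl)
  · rw [← hprod, ← volume_Ioo_box]
    have hcc : ∀ (s : ℝ) (k : ℕ), k < K → s ∈ Set.Ioo ((k : ℝ) / K) (k / K + 1 / K) →
        s ∈ Set.Icc (0 : ℝ) 1 ∧ cellCoord K s = k := by
      intro s k hk hs
      rw [Set.mem_Ioo, ← add_div, div_lt_iff₀ hK', lt_div_iff₀ hK'] at hs
      have hk' : (k : ℝ) + 1 ≤ K := by exact_mod_cast hk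
      have hk0 : (0 : ℝ) ≤ k := Nat.cast_nonneg k
      refine ⟨⟨?_, ?_⟩, cellCoord_eq hk (by linarith [hs.1]) (by linarith [hs.2])⟩
      · by_contra h
        nlinarith [hs.1]
      · by_contra h
        nlinarith [hs.2]
    refine measure_mono fun x hx => ?_
    have h0 := hcc (x 0) c.1 hc.1 (hx 0)
    have h1 := hcc (x 1) c.2 hc.2 (hx 1)
    refine ⟨fun i => ?_, Prod.ext h0.2 h1.2⟩
    fin_cases i
    · exact h0.1
    · exact h1.1

/-! ### Concentration of the numbers of nodes in the cells -/

/-- All nodes are in the square and every cell of the `K × K` grid contains between `l` and `u` of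
them. -/
structure Balanced {n : ℕ} (K : ℕ) (l u : ℝ) (x : Fin n → Plane) : Prop where
  mem_square : ∀ i, x i ∈ square
  le_card : ∀ c ∈ grid K, l ≤ ((Finset.univ.filter fun i => cell K (x i) = c).card : ℝ)
  card_le : ∀ c ∈ grid K, ((Finset.univ.filter fun i => cell K (x i) = c).card : ℝ) ≤ u

section Chernoff

variable {n : ℕ} {μ : Measure Plane} [IsProbabilityMeasure μ] {A : Set Plane}

lemma measureReal_mul_sum_indicator_ge_le (hA : MeasurableSet A) (s τ : ℝ) :
    (Measure.pi fun _ : Fin n => μ).real {x | τ ≤ s * ∑ i, A.indicator 1 (x i)}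
      ≤ Real.exp (n * μ.real A * (Real.exp s - 1) - τ) := by
  have hexp : ∀ z, Real.exp (s * A.indicator 1 z) =
      1 + A.indicator 1 z * (Real.exp s - 1) := by
    intro z
    by_cases hz : z ∈ A <;> simp [hz]
  have hm : Measurable fun x : Fin n → Plane => s * ∑ i, A.indicator (1 : Plane → ℝ) (x i) :=
    (Finset.measurable_sum _ fun i _ => ((measurable_one (α := ℝ)).indicator hA).comp
      (measurable_pi_apply i)).const_mul s
  have hI : Integrable (A.indicator (1 : Plane → ℝ)) μ := (integrable_const (1 : ℝ)).indicator hA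
  have hmgf : ∫ x : Fin n → Plane, Real.exp (s * ∑ i, A.indicator 1 (x i))
      ∂(Measure.pi fun _ => μ) = (1 + μ.real A * (Real.exp s - 1)) ^ n := by
    simp only [Finset.mul_sum, Real.exp_sum]
    rw [integral_fintype_prod_eq_pow (fun z => Real.exp (s * A.indicator 1 z)), Fintype.card_fin]
    simp only [hexp]
    rw [integral_add (integrable_const _) (hI.mul_const _), integral_mul_const,
      integral_indicator_one hA]
    simp
  have hint : Integrable (fun x : Fin n → Plane => Real.exp (s * ∑ i, A.indicator 1 (x i)))
      (Measure.pi fun _ => μ) := by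
    refine Integrable.of_bound (C := Real.exp (|s| * n))
      (Real.measurable_exp.comp hm).aestronglyMeasurable (ae_of_all _ fun x => ?_)
    have h0 : 0 ≤ ∑ i, A.indicator (1 : Plane → ℝ) (x i) :=
      Finset.sum_nonneg fun i _ => Set.indicator_nonneg (fun _ _ => zero_le_one) _
    have h1 : ∑ i, A.indicator (1 : Plane → ℝ) (x i) ≤ n := by
      calc _ ≤ ∑ _ : Fin n, (1 : ℝ) := Finset.sum_le_sum fun i _ =>
            Set.indicator_le_self' (fun _ _ => zero_le_one) _
        _ = n := by simp
    rw [Real.norm_eq_abs, abs_of_pos (Real.exp_pos _), Real.exp_le_exp]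
    calc _ ≤ |s| * ∑ i, A.indicator (1 : Plane → ℝ) (x i) :=
          mul_le_mul_of_nonneg_right (le_abs_self s) h0
      _ ≤ _ := by gcongr
  have hmarkov := mul_meas_ge_le_integral_of_nonneg (μ := Measure.pi fun _ : Fin n => μ)
    (ae_of_all _ fun x => (Real.exp_pos _).le) hint (Real.exp τ)
  rw [hmgf] at hmarkov
  simp only [Real.exp_le_exp] at hmarkov
  have hbase : 0 ≤ 1 + μ.real A * (Real.exp s - 1) := by
    have h0 : 0 ≤ μ.real A := measureReal_nonneg
    have h1 : μ.real A ≤ 1 := measureReal_le_one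
    nlinarith [Real.exp_pos s]
  have hpow : (1 + μ.real A * (Real.exp s - 1)) ^ n ≤
      Real.exp (n * μ.real A * (Real.exp s - 1)) := by
    calc _ ≤ Real.exp (μ.real A * (Real.exp s - 1)) ^ n :=
          pow_le_pow_left₀ hbase (by linarith [Real.add_one_le_exp (μ.real A * (Real.exp s - 1))]) n
      _ = _ := by rw [← Real.exp_nat_mul]; congr 1; ring
  rw [Real.exp_sub, le_div_iff₀ (Real.exp_pos τ), mul_comm]
  exact hmarkov.trans hpow

lemma sum_indicator_preimage_eq_card (g : Plane → ℕ × ℕ) (c : ℕ × ℕ) (x : Fin n → Plane) :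
    ∑ i, (g ⁻¹' {c}).indicator 1 (x i) =
      ((Finset.univ.filter fun i => g (x i) = c).card : ℝ) := by
  classical
  rw [← Finset.sum_boole]
  refine Finset.sum_congr rfl fun i _ => ?_
  simp [Set.indicator_apply]

lemma measureReal_card_cell_ge_le {K : ℕ} {c : ℕ × ℕ} {e : ℝ}
    (h : n * μ.real (cell K ⁻¹' {c}) ≤ e) :
    (Measure.pi fun _ : Fin n => μ).real
      {x | 3 * e ≤ ((Finset.univ.filter fun i => cell K (x i) = c).card : ℝ)}
      ≤ Real.exp (-e) := by
  have h1 := measureReal_mul_sum_indicator_ge_le (n := n) (μ := μ)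
    (measurable_cell K (measurableSet_singleton c)) 1 (3 * e)
  simp only [one_mul, sum_indicator_preimage_eq_card] at h1
  refine h1.trans (Real.exp_le_exp.2 ?_)
  have h0 : 0 ≤ n * μ.real (cell K ⁻¹' {c}) := by positivity
  nlinarith [Real.exp_one_lt_d9, Real.add_one_le_exp (1 : ℝ)]

lemma measureReal_card_cell_le_le {K : ℕ} {c : ℕ × ℕ} {e : ℝ}
    (h : e ≤ n * μ.real (cell K ⁻¹' {c})) :
    (Measure.pi fun _ : Fin n => μ).real
      {x | ((Finset.univ.filter fun i => cell K (x i) = c).card : ℝ) ≤ e / 4}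
      ≤ Real.exp (-(e / 4)) := by
  have h1 := measureReal_mul_sum_indicator_ge_le (n := n) (μ := μ)
    (measurable_cell K (measurableSet_singleton c)) (-1) (-(e / 4))
  simp only [neg_mul, one_mul, sum_indicator_preimage_eq_card, neg_le_neg_iff] at h1
  refine h1.trans (Real.exp_le_exp.2 ?_)
  have h0 : 0 ≤ n * μ.real (cell K ⁻¹' {c}) := by positivity
  have h2 : Real.exp (-1) ≤ 1 / 2 := by
    rw [Real.exp_neg, one_div]
    exact inv_anti₀ (by norm_num) (by linarith [Real.add_one_le_exp (1 : ℝ)])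
  nlinarith

end Chernoff

/-- A law that is comparable with the uniform one makes the cells balanced: Chernoff's bounds for
the number of nodes in each cell, and the union bound. -/
lemma measureReal_not_balanced_le {n K : ℕ} (hK : 0 < K) {μ : Measure Plane}
    [IsProbabilityMeasure μ] (h₁ : μ ≤ (1024 : ℝ≥0∞) • uniformLaw)
    (h₂ : uniformLaw ≤ (1024 : ℝ≥0∞) • μ) {m : ℝ} (hm : m = n / (K : ℝ) ^ 2) :
    (Measure.pi fun _ : Fin n => μ).real {x | ¬ Balanced K (m / 4096) (3072 * m) x}
      ≤ 2 * (K : ℝ) ^ 2 * Real.exp (-(m / 4096)) := by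
  have hK' : (0 : ℝ) < K := by exact_mod_cast hK
  have hm0 : 0 ≤ m := by rw [hm]; positivity
  have hnm : (n : ℝ) * (1 / (K : ℝ) ^ 2) = m := by rw [hm]; ring
  have hup : ∀ c ∈ grid K, n * μ.real (cell K ⁻¹' {c}) ≤ 1024 * m := by
    intro c hc
    have h := h₁ (cell K ⁻¹' {c})
    rw [Measure.smul_apply, smul_eq_mul, uniformLaw_cell hK hc] at h
    have h' : μ.real (cell K ⁻¹' {c}) ≤ 1024 * (1 / (K : ℝ) ^ 2) := by
      refine ENNReal.toReal_le_of_le_ofReal (by positivity) (h.trans_eq ?_)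
      rw [ENNReal.ofReal_mul (by norm_num)]
      norm_num
    rw [← hnm]
    nlinarith [(Nat.cast_nonneg n : (0 : ℝ) ≤ n)]
  have hlo : ∀ c ∈ grid K, m / 1024 ≤ n * μ.real (cell K ⁻¹' {c}) := by
    intro c hc
    have h := h₂ (cell K ⁻¹' {c})
    rw [Measure.smul_apply, smul_eq_mul, uniformLaw_cell hK hc] at h
    have h' : 1 / (K : ℝ) ^ 2 ≤ 1024 * μ.real (cell K ⁻¹' {c}) := by
      have := (ENNReal.ofReal_le_iff_le_toReal
        (ENNReal.mul_ne_top (by norm_num) (measure_ne_top _ _))).1 h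
      simpa [ENNReal.toReal_mul, measureReal_def] using this
    rw [← hnm]
    nlinarith [(Nat.cast_nonneg n : (0 : ℝ) ≤ n)]
  set Q := Measure.pi fun _ : Fin n => μ with hQ
  set U : ℕ × ℕ → Set (Fin n → Plane) := fun c =>
    {x | 3 * (1024 * m) ≤ ((Finset.univ.filter fun i => cell K (x i) = c).card : ℝ)} with hU
  set L : ℕ × ℕ → Set (Fin n → Plane) := fun c =>
    {x | ((Finset.univ.filter fun i => cell K (x i) = c).card : ℝ) ≤ m / 1024 / 4} with hL
  have hout : Q.real {x | ∃ i, x i ∉ square} = 0 := by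
    have h0 : μ squareᶜ = 0 := by simpa [uniformLaw_apply] using h₁ squareᶜ
    have : Q {x | ∃ i, x i ∉ square} = 0 := by
      rw [Set.ofPred_exists]
      refine measure_iUnion_null fun i => ?_
      have := (measurePreserving_eval (fun _ : Fin n => μ) i).measure_preimage
        measurableSet_square.compl.nullMeasurableSet
      rw [h0] at this
      exact this
    rw [measureReal_def, this, ENNReal.toReal_zero]
  have hsub : {x | ¬ Balanced K (m / 4096) (3072 * m) x} ⊆
      {x : Fin n → Plane | ∃ i, x i ∉ square} ∪ ⋃ c ∈ grid K, (L c ∪ U c) := by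
    intro x hx
    by_contra hcon
    simp only [Set.mem_union, Set.mem_ofPred_eq, Set.mem_iUnion, not_or, not_exists, not_not] at hcon
    refine hx ⟨hcon.1, fun c hc => ?_, fun c hc => ?_⟩
    · have := (hcon.2 c hc).1
      simp only [hL, Set.mem_ofPred_eq, not_le] at this
      linarith
    · have := (hcon.2 c hc).2
      simp only [hU, Set.mem_ofPred_eq, not_le] at this
      linarith
  calc Q.real {x | ¬ Balanced K (m / 4096) (3072 * m) x}
      ≤ Q.real {x : Fin n → Plane | ∃ i, x i ∉ square} + Q.real (⋃ c ∈ grid K, (L c ∪ U c)) :=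
        (measureReal_mono hsub).trans (measureReal_union_le _ _)
    _ ≤ 0 + ∑ c ∈ grid K, (Q.real (L c) + Q.real (U c)) := by
        rw [hout]
        gcongr
        exact (measureReal_biUnion_finset_le _ _).trans
          (Finset.sum_le_sum fun c _ => measureReal_union_le _ _)
    _ ≤ 0 + ∑ c ∈ grid K, (Real.exp (-(m / 4096)) + Real.exp (-(m / 4096))) := by
        gcongr with c hc
        · refine (measureReal_card_cell_le_le (hlo c hc)).trans (Real.exp_le_exp.2 (by linarith))
        · refine (measureReal_card_cell_ge_le (hup c hc)).trans (Real.exp_le_exp.2 (by linarith))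
    _ = _ := by
        rw [Finset.sum_const, grid, Finset.card_product, Finset.card_range, nsmul_eq_mul]
        push_cast
        ring

/-! ### The conductance of a balanced configuration -/

/-- The number of cells per side of the grid, chosen such that nodes in touching cells have distance
at most `max v r / 16`. -/
noncomputable def gridSize (v r : ℝ) : ℕ := ⌈48 / max v r⌉₊

/-- The mean number of nodes per cell for uniform positions. -/
noncomputable def cellMean (n : ℕ) (v r : ℝ) : ℝ := n / (gridSize v r : ℝ) ^ 2

section Conductance

variable {n : ℕ} {v r : ℝ} {x : Fin n → Plane}

lemma max_pos_of_range_pos (hr : 0 < r) : 0 < max v r := hr.trans_le (le_max_right _ _)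

lemma max_le_two (hv' : v ≤ √2) (hr' : r ≤ √2) : max v r ≤ 2 :=
  (max_le hv' hr').trans (Real.sqrt_le_iff.2 ⟨by norm_num, by norm_num⟩)

lemma le_gridSize_mul (hr : 0 < r) : 48 ≤ gridSize v r * max v r :=
  (div_le_iff₀ (max_pos_of_range_pos hr)).1 (Nat.le_ceil _)

lemma gridSize_mul_le (hv' : v ≤ √2) (hr : 0 < r) (hr' : r ≤ √2) :
    gridSize v r * max v r ≤ 50 := by
  have hd := max_pos_of_range_pos (v := v) hr
  have h1 : (gridSize v r : ℝ) < 48 / max v r + 1 := Nat.ceil_lt_add_one (by positivity)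
  have h2 := max_le_two hv' hr'
  have h3 : (48 / max v r + 1) * max v r = 48 + max v r := by field_simp
  nlinarith

lemma gridSize_mul_dist_le (hv' : v ≤ √2) (hr : 0 < r) (hr' : r ≤ √2) {y z : Plane}
    (h : dist y z ≤ 3 * max v r) : gridSize v r * dist y z ≤ (150 : ℕ) := by
  calc gridSize v r * dist y z ≤ gridSize v r * (3 * max v r) := by gcongr
    _ = 3 * (gridSize v r * max v r) := by ring
    _ ≤ 3 * 50 := by
        gcongr
        exact gridSize_mul_le hv' hr hr'
    _ = (150 : ℕ) := by norm_num

lemma le_gridSize (hv' : v ≤ √2) (hr : 0 < r) (hr' : r ≤ √2) : 24 ≤ gridSize v r := by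
  have h1 := le_gridSize_mul (v := v) hr
  have h2 := max_le_two hv' hr'
  have h3 : (0 : ℝ) ≤ gridSize v r := Nat.cast_nonneg _
  have : (24 : ℝ) ≤ gridSize v r := by nlinarith
  exact_mod_cast this

lemma contactRatio_mul_sq (hr : 0 < r) : contactRatio v r * max v r ^ 2 = r ^ 2 := by
  have hd := max_pos_of_range_pos (v := v) hr
  rw [contactRatio, div_pow]
  field_simp

lemma cellMean_mul_sq (hv' : v ≤ √2) (hr : 0 < r) (hr' : r ≤ √2) :
    cellMean n v r * (gridSize v r : ℝ) ^ 2 = n := by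
  have : (0 : ℝ) < gridSize v r := by
    have := le_gridSize hv' hr hr'
    exact_mod_cast (by omega : 0 < gridSize v r)
  rw [cellMean]
  field_simp

lemma cellMean_pos (hn : 0 < n) (hv' : v ≤ √2) (hr : 0 < r) (hr' : r ≤ √2) :
    0 < cellMean n v r := by
  have h1 := le_gridSize hv' hr hr'
  have : (0 : ℝ) < gridSize v r := by exact_mod_cast (by omega : 0 < gridSize v r)
  have hn' : (0 : ℝ) < n := by exact_mod_cast hn
  unfold cellMean
  positivity

/-- All nodes are in the square and the number of nodes in each cell of the grid of size
`gridSize v r` is `cellMean n v r` up to constant factors. -/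
abbrev BalancedAt (n : ℕ) (v r : ℝ) (x : Fin n → Plane) : Prop :=
  Balanced (gridSize v r) (cellMean n v r / 4096) (3072 * cellMean n v r) x

/-- The constant in the lower bound for the expected number of edges across a cut. Here
`2 ^ 20 = 65536 * 16` comes from the contact probability and the expansion of the grid,
`12582912 = 3072 * 4096` is the ratio of the bounds for the cells, and `125000 = 50 ^ 3` bounds
`(gridSize v r * max v r) ^ 3`. -/
noncomputable def edgeConst : ℝ := 1 / (2 ^ 20 * 12582912 ^ 2 * 125000)

lemma edgeConst_pos : 0 < edgeConst := by unfold edgeConst; positivity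

/-- Edge expansion of the grid gives the lower bound for the expected number of edges across a
cut, because nodes in touching cells become neighbours with probability of order
`contactRatio v r`. -/
lemma le_sum_transition_nearEvent (hn : 0 < n) (hv : 0 ≤ v) (hv' : v ≤ √2) (hr : 0 < r)
    (hr' : r ≤ √2) (hx : BalancedAt n v r x) (S : Cut n) :
    edgeConst * (n * r ^ 2 * max v r * S.1.card)
      ≤ ∑ i ∈ S.1, ∑ j ∈ S.1ᶜ, (transition v x).real (nearEvent n r i j) := by
  obtain ⟨S, hS, hS2⟩ := S
  dsimp only
  have hd := max_pos_of_range_pos (v := v) hr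
  have hK := le_gridSize hv' hr hr'
  have hK0 : 0 < gridSize v r := by omega
  have hm := cellMean_pos hn hv' hr hr'
  have hKd := gridSize_mul_le hv' hr hr'
  have hKd' := le_gridSize_mul (v := v) hr
  have hρ := contactRatio_mul_sq (v := v) hr
  have hρ0 := contactRatio_nonneg v r
  set K := gridSize v r with hKdef
  set m := cellMean n v r with hmdef
  set d := max v r with hddef
  set T := touchingPairs (fun i => cell K (x i)) S with hT
  have hK' : (0 : ℝ) < K := by exact_mod_cast hK0
  have hn' : (0 : ℝ) < n := by exact_mod_cast hn
  have hexp := card_mul_card_compl_le_touchingPairs (fun i => cell K (x i)) S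
    (by positivity : 0 < m / 4096) (fun i => cell_mem_grid hK0 (x i)) hx.le_card hx.card_le
  have hSc : (n : ℝ) / 2 ≤ (Sᶜ.card : ℝ) := by
    have h := Finset.card_add_card_compl S
    rw [Fintype.card_fin] at h
    have h' : (S.card : ℝ) + Sᶜ.card = n := by exact_mod_cast h
    linarith
  have hs0 : (0 : ℝ) ≤ S.card := Nat.cast_nonneg _
  -- the factor `3072 * 4096 = 12582912` is the ratio of the two bounds for the cells
  have hT1 : n * S.card ≤ 16 * 12582912 ^ 2 * (K : ℝ) ^ 3 * T := by
    have h1 : (S.card : ℝ) * (n / 2) ≤ S.card * Sᶜ.card := by gcongr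
    have h2 : (m / 4096) ^ 2 * (n * S.card) ≤
        (m / 4096) ^ 2 * (16 * 12582912 ^ 2 * (K : ℝ) ^ 3 * T) := by
      calc (m / 4096) ^ 2 * (n * S.card) = 2 * ((m / 4096) ^ 2 * (S.card * (n / 2))) := by ring
        _ ≤ 2 * ((m / 4096) ^ 2 * (S.card * Sᶜ.card)) := by gcongr
        _ ≤ 2 * (8 * (3072 * m) ^ 2 * (K : ℝ) ^ 3 * T) := by gcongr
        _ = _ := by ring
    exact le_of_mul_le_mul_left h2 (by positivity)
  have hT0 : 0 ≤ T := by
    rw [hT, touchingPairs]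
    exact Finset.sum_nonneg fun i _ => Finset.sum_nonneg fun j _ => by split_ifs <;> norm_num
  have hKd3 : ((K : ℝ) * d) ^ 3 ≤ 125000 := by
    calc ((K : ℝ) * d) ^ 3 ≤ 50 ^ 3 := by gcongr
      _ = 125000 := by norm_num
  have hT2 : n * d ^ 3 * S.card ≤ 16 * 12582912 ^ 2 * 125000 * T := by
    calc n * d ^ 3 * S.card = d ^ 3 * (n * S.card) := by ring
      _ ≤ d ^ 3 * (16 * 12582912 ^ 2 * (K : ℝ) ^ 3 * T) := by gcongr
      _ = 16 * 12582912 ^ 2 * ((K : ℝ) * d) ^ 3 * T := by ring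
      _ ≤ _ := by gcongr
  calc edgeConst * (n * r ^ 2 * d * S.card)
      = edgeConst * contactRatio v r * (n * d ^ 3 * S.card) := by rw [← hρ]; ring
    _ ≤ edgeConst * contactRatio v r * (16 * 12582912 ^ 2 * 125000 * T) := by
        have := edgeConst_pos
        gcongr
    _ = contactRatio v r / 65536 * T := by rw [edgeConst]; ring
    _ ≤ _ := by
        rw [hT, touchingPairs, Finset.mul_sum]
        refine Finset.sum_le_sum fun i hi => ?_
        rw [Finset.mul_sum]
        refine Finset.sum_le_sum fun j hj => ?_
        have hij : i ≠ j := fun h => Finset.mem_compl.1 hj (h ▸ hi)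
        split_ifs with ht
        · rw [mul_one]
          refine le_transition_nearEvent hv hv' hr hr' hx.mem_square hij ?_
          refine (dist_le_of_touching hK0 (hx.mem_square i) (hx.mem_square j) ht).trans ?_
          rw [← hddef, div_le_div_iff₀ hK' (by norm_num)]
          linarith
        · rw [mul_zero]
          exact measureReal_nonneg

/-- In a balanced configuration every node can reach only of the order of `cellMean n v r` nodes. -/
lemma card_dist_le_le (hv' : v ≤ √2) (hr : 0 < r) (hr' : r ≤ √2)
    (hx : BalancedAt n v r x) (i : Fin n) :
    ((Finset.univ.filter fun k => dist (x i) (x k) ≤ 3 * max v r).card : ℝ)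
      ≤ 3072 * cellMean n v r * 303 ^ 2 := by
  have hK0 : 0 < gridSize v r := by have := le_gridSize hv' hr hr'; omega
  have hKd := gridSize_mul_le hv' hr hr'
  have hm0 : 0 ≤ cellMean n v r := by unfold cellMean; positivity
  set K := gridSize v r
  set c := cell K (x i) with hc
  obtain ⟨F, hF⟩ : ∃ F : Finset (ℕ × ℕ), F =
      (Finset.Icc (c.1 - 151) (c.1 + 151) ×ˢ Finset.Icc (c.2 - 151) (c.2 + 151)) ∩ grid K :=
    ⟨_, rfl⟩
  have hFK : F ⊆ grid K := hF ▸ Finset.inter_subset_right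
  have hW : F.card ≤ 303 ^ 2 := by
    rw [hF]
    refine (Finset.card_le_card Finset.inter_subset_left).trans ?_
    have hI : ∀ a : ℕ, a + 151 + 1 - (a - 151) ≤ 303 := fun a => by omega
    rw [Finset.card_product, Nat.card_Icc, Nat.card_Icc, sq]
    gcongr
    · exact hI c.1
    · exact hI c.2
  calc _ ≤ ((Finset.univ.filter fun k => cell K (x k) ∈ F).card : ℝ) := by
        refine Nat.cast_le.2 (Finset.card_le_card fun k hk => ?_)
        simp only [Finset.mem_filter, Finset.mem_univ, true_and] at hk ⊢
        have h1 : (K : ℝ) * dist (x i) (x k) ≤ (150 : ℕ) := gridSize_mul_dist_le hv' hr hr' hk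
        have h2 : (K : ℝ) * dist (x k) (x i) ≤ (150 : ℕ) := by rwa [dist_comm]
        have e1 := cellCoord_le_of_dist_le hK0 (hx.mem_square i) (hx.mem_square k) h1
        have e2 := cellCoord_le_of_dist_le hK0 (hx.mem_square k) (hx.mem_square i) h2
        have hg := cell_mem_grid hK0 (x k)
        have a1 := e1 0
        have a2 := e1 1
        have b1 := e2 0
        have b2 := e2 1
        simp only [hF, Finset.mem_inter, Finset.mem_product, Finset.mem_Icc, hg, and_true]
        simp only [hc, cell]
        omega
    _ ≤ 3072 * cellMean n v r * (F.card : ℝ) :=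
        card_filter_mem_le (fun k => cell K (x k)) F
          fun c hc => hx.card_le c (hFK hc)
    _ ≤ _ := by
        gcongr
        exact_mod_cast hW

/-- The cut along a vertical grid line in the middle of the square: it has a side `S` with a
constant fraction of the nodes, at most half of them, and all nodes of `S` that can have a neighbour
across the cut after the move lie in a set `B` of cells near the line. -/
lemma exists_bisecting_cut (hn : 0 < n) (hv' : v ≤ √2) (hr : 0 < r) (hr' : r ≤ √2)
    (hx : BalancedAt n v r x) :
    ∃ (S : Cut n) (B : Finset (Fin n)), (n : ℝ) / 12288 ≤ S.1.card ∧
      (B.card : ℝ) ≤ 3072 * cellMean n v r * (302 * gridSize v r) ∧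
      ∀ i ∈ S.1, ∀ j ∈ S.1ᶜ, dist (x i) (x j) ≤ 3 * max v r → i ∈ B := by
  have hK := le_gridSize hv' hr hr'
  have hK0 : 0 < gridSize v r := by omega
  have hKd := gridSize_mul_le hv' hr hr'
  have hm := cellMean_pos hn hv' hr hr'
  have hmK := cellMean_mul_sq (n := n) hv' hr hr'
  set K := gridSize v r
  set m := cellMean n v r
  have hK' : (0 : ℝ) < K := by exact_mod_cast hK0
  have hn' : (0 : ℝ) < n := by exact_mod_cast hn
  set h := K / 2 with hh
  obtain ⟨F, hF⟩ : ∃ F : Finset (ℕ × ℕ), F =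
      (Finset.Ico (h - 151) (h + 151) ×ˢ Finset.range K) ∩ grid K := ⟨_, rfl⟩
  have hFK : F ⊆ grid K := hF ▸ Finset.inter_subset_right
  have hFc : F.card ≤ 302 * K := by
    rw [hF]
    refine (Finset.card_le_card Finset.inter_subset_left).trans ?_
    have hI : h + 151 - (h - 151) ≤ 302 := by omega
    rw [Finset.card_product, Nat.card_Ico, Finset.card_range]
    gcongr
  set B : Finset (Fin n) := Finset.univ.filter fun i => cell K (x i) ∈ F with hB
  have hBc : (B.card : ℝ) ≤ 3072 * m * (302 * K) := by
    calc (B.card : ℝ) ≤ 3072 * m * (F.card : ℝ) :=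
          card_filter_mem_le (fun k => cell K (x k)) F
            fun c hc => hx.card_le c (hFK hc)
      _ ≤ _ := by
          gcongr
          exact_mod_cast hFc
  -- half of the grid contains at least a third of the cells
  have hside : ∀ I : Finset ℕ, I ⊆ Finset.range K → K ≤ 3 * I.card →
      (n : ℝ) / 12288 ≤
        ((Finset.univ.filter fun i => cell K (x i) ∈ I ×ˢ Finset.range K).card : ℝ) := by
    intro I hI hcard
    refine le_trans ?_ (le_card_filter_mem (fun k => cell K (x k)) (I ×ˢ Finset.range K)
      fun c hc => hx.le_card c (Finset.product_subset_product_left hI hc))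
    rw [Finset.card_product, Finset.card_range, Nat.cast_mul]
    have hcard' : (K : ℝ) ≤ 3 * I.card := by exact_mod_cast hcard
    calc (n : ℝ) / 12288 = m / 4096 * (K / 3 * K) := by rw [← hmK]; ring
      _ ≤ m / 4096 * (I.card * K) := by
          gcongr
          linarith
  set S₀ : Finset (Fin n) := Finset.univ.filter fun i => cell K (x i) ∈ Finset.range h ×ˢ
    Finset.range K with hS₀
  have hS₀c : S₀ᶜ = Finset.univ.filter fun i => cell K (x i) ∈ Finset.Ico h K ×ˢ
      Finset.range K := by
    ext i
    have := cell_mem_grid hK0 (x i)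
    simp only [grid, Finset.mem_product, Finset.mem_range] at this
    simp only [hS₀, Finset.mem_compl, Finset.mem_filter, Finset.mem_univ, true_and,
      Finset.mem_product, Finset.mem_range, Finset.mem_Ico]
    omega
  have h1 : (n : ℝ) / 12288 ≤ S₀.card := by
    refine hside _ (fun k hk => ?_) (by rw [Finset.card_range]; omega)
    simp only [Finset.mem_range] at hk ⊢
    omega
  have h2 : (n : ℝ) / 12288 ≤ S₀ᶜ.card := by
    rw [hS₀c]
    refine hside _ (fun k hk => ?_) (by rw [Nat.card_Ico]; omega)
    simp only [Finset.mem_range, Finset.mem_Ico] at hk ⊢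
    omega
  have hcross : ∀ i ∈ S₀, ∀ j ∈ S₀ᶜ, dist (x i) (x j) ≤ 3 * max v r → i ∈ B ∧ j ∈ B := by
    intro i hi j hj hd
    rw [hS₀c] at hj
    simp only [hS₀, Finset.mem_filter, Finset.mem_univ, true_and,
      Finset.mem_product, Finset.mem_range, Finset.mem_Ico] at hi hj
    have hd2 : (K : ℝ) * dist (x j) (x i) ≤ (150 : ℕ) := by
      rw [dist_comm]
      exact gridSize_mul_dist_le hv' hr hr' hd
    have e := cellCoord_le_of_dist_le hK0 (hx.mem_square j) (hx.mem_square i) hd2 0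
    have ei := cell_mem_grid hK0 (x i)
    have ej := cell_mem_grid hK0 (x j)
    simp only [hB, hF, Finset.mem_filter, Finset.mem_univ, true_and, Finset.mem_inter,
      Finset.mem_product, Finset.mem_range, Finset.mem_Ico, ei, ej, and_true]
    simp only [cell] at hi hj ⊢
    omega
  have hsum : (S₀.card : ℝ) + S₀ᶜ.card = n := by
    have h := Finset.card_add_card_compl S₀
    rw [Fintype.card_fin] at h
    exact_mod_cast h
  have hne : ∀ {S : Finset (Fin n)}, (n : ℝ) / 12288 ≤ S.card → S.Nonempty := fun h =>
    Finset.card_pos.1 (by exact_mod_cast (by positivity : (0 : ℝ) < n / 12288).trans_le h)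
  rcases le_total (S₀.card : ℝ) (n / 2) with hle | hle
  · exact ⟨⟨S₀, hne h1, hle⟩, B, h1, hBc, fun i hi j hj hd => (hcross i hi j hj hd).1⟩
  · refine ⟨⟨S₀ᶜ, hne h2, by linarith⟩, B, h2, hBc, fun i hi j hj hd => ?_⟩
    rw [compl_compl] at hj
    exact (hcross j hj i hi (by rwa [dist_comm])).2

lemma gridSize_mul_cellMean_eq (hv' : v ≤ √2) (hr : 0 < r) (hr' : r ≤ √2) :
    cellMean n v r * gridSize v r = n / gridSize v r := by
  have hK : (0 : ℝ) < gridSize v r := by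
    have := le_gridSize hv' hr hr'
    exact_mod_cast (by omega : 0 < gridSize v r)
  rw [cellMean]
  field_simp

lemma inv_gridSize_le (hv' : v ≤ √2) (hr : 0 < r) (hr' : r ≤ √2) :
    1 / (gridSize v r : ℝ) ≤ max v r := by
  have hK : (0 : ℝ) < gridSize v r := by
    have := le_gridSize hv' hr hr'
    exact_mod_cast (by omega : 0 < gridSize v r)
  rw [div_le_iff₀ hK]
  linarith [le_gridSize_mul (v := v) hr]

/-- The constant in the upper bound for the edge-counting conductance: the contact probability is at
most `32 * contactRatio v r`, the nodes near the bisecting line are in `302` columns of cells, each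
of them reaches at most `303 ^ 2` cells, a cell has at most `3072` times the mean number of nodes,
and the cut has at least `n / 12288` nodes. -/
noncomputable def edgeUpperConst : ℝ := 32 * 302 * 303 ^ 2 * 3072 ^ 2 * 12288

theorem edgeMobileConductance_bounds (hn : 0 < n) (hv : 0 ≤ v) (hv' : v ≤ √2) (hr : 0 < r)
    (hr' : r ≤ √2) (hx : BalancedAt n v r x) :
    edgeConst / 4 * max v r ≤ edgeMobileConductance v r x ∧
      edgeMobileConductance v r x ≤ edgeUpperConst * max v r := by
  obtain ⟨S₀, B, hS₀, hB, hcross⟩ := exists_bisecting_cut hn hv' hr hr' hx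
  have hd := max_pos_of_range_pos (v := v) hr
  have hn' : (0 : ℝ) < n := by exact_mod_cast hn
  have hpi := Real.pi_pos
  constructor
  · have : Nonempty (Cut n) := ⟨S₀⟩
    refine le_ciInf fun S => ?_
    have hS : (0 : ℝ) < S.1.card := by exact_mod_cast Finset.card_pos.2 S.2.1
    rw [integral_crossEdges hv hv' hx.mem_square]
    have hec := edgeConst_pos
    calc edgeConst / 4 * max v r ≤ edgeConst / Real.pi * max v r := by
          gcongr
          exact Real.pi_le_four
      _ = 1 / (n * Real.pi * r ^ 2) / S.1.card *
            (edgeConst * (n * r ^ 2 * max v r * S.1.card)) := by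
          field_simp
      _ ≤ _ := by
          gcongr
          exact le_sum_transition_nearEvent hn hv hv' hr hr' hx S
  · refine (ciInf_le (Set.finite_range _).bddBelow S₀).trans ?_
    have hρ := contactRatio_mul_sq (v := v) hr
    have hρ0 := contactRatio_nonneg v r
    have hm := cellMean_pos hn hv' hr hr'
    have hKm := gridSize_mul_cellMean_eq (n := n) hv' hr hr'
    have hK := inv_gridSize_le hv' hr hr'
    have hK0 : (0 : ℝ) < gridSize v r := by
      have := le_gridSize hv' hr hr'
      exact_mod_cast (by omega : 0 < gridSize v r)
    have hS : (0 : ℝ) < S₀.1.card := lt_of_lt_of_le (by positivity) hS₀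
    rw [integral_crossEdges hv hv' hx.mem_square]
    -- each node of `B` has at most `303 ^ 2 * 3072 * cellMean n v r` potential neighbours
    have hsum : ∑ i ∈ S₀.1, ∑ j ∈ S₀.1ᶜ, (transition v x).real (nearEvent n r i j)
        ≤ B.card * (3072 * cellMean n v r * 303 ^ 2 * (32 * contactRatio v r)) := by
      calc _ ≤ ∑ i ∈ S₀.1, if i ∈ B then
              3072 * cellMean n v r * 303 ^ 2 * (32 * contactRatio v r) else 0 := by
            refine Finset.sum_le_sum fun i hi => ?_
            have hne : ∀ j ∈ S₀.1ᶜ, i ≠ j := fun j hj h => Finset.mem_compl.1 hj (h ▸ hi)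
            have hzero : ∀ j ∈ S₀.1ᶜ, ¬ dist (x i) (x j) ≤ 3 * max v r →
                (transition v x).real (nearEvent n r i j) = 0 := fun j hj h => by
              rw [measureReal_def, transition_nearEvent_eq_zero hv hv' hx.mem_square (hne j hj)
                (not_le.1 h), ENNReal.toReal_zero]
            split_ifs with hiB
            · calc _ ≤ ∑ j ∈ S₀.1ᶜ, if dist (x i) (x j) ≤ 3 * max v r then
                      32 * contactRatio v r else 0 := by
                    refine Finset.sum_le_sum fun j hj => ?_
                    split_ifs with hdist
                    · exact transition_nearEvent_le hv hv' hr hx.mem_square (hne j hj)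
                    · exact (hzero j hj hdist).le
                _ ≤ ∑ j, if dist (x i) (x j) ≤ 3 * max v r then
                      32 * contactRatio v r else 0 := by
                    refine Finset.sum_le_sum_of_subset_of_nonneg (Finset.subset_univ _)
                      fun j _ _ => ?_
                    split_ifs <;> positivity
                _ ≤ _ := by
                    rw [← Finset.sum_filter, Finset.sum_const, nsmul_eq_mul]
                    gcongr
                    exact card_dist_le_le hv' hr hr' hx i
            · exact (Finset.sum_eq_zero fun j hj =>
                hzero j hj fun h => hiB (hcross i hi j hj h)).le
        _ ≤ ∑ i, if i ∈ B then
              3072 * cellMean n v r * 303 ^ 2 * (32 * contactRatio v r) else 0 := by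
            refine Finset.sum_le_sum_of_subset_of_nonneg (Finset.subset_univ _) fun i _ _ => ?_
            split_ifs <;> positivity
        _ = _ := by simp [Finset.sum_ite_mem]
    have hKd : cellMean n v r * (gridSize v r : ℝ) * (cellMean n v r * contactRatio v r)
        ≤ n ^ 2 * r ^ 2 * max v r := by
      have h3 : (1 / (gridSize v r : ℝ)) * contactRatio v r / gridSize v r ^ 2
          ≤ r ^ 2 * max v r := by
        calc _ = contactRatio v r * (1 / (gridSize v r : ℝ)) ^ 2 * (1 / (gridSize v r : ℝ)) := by
              ring
          _ ≤ contactRatio v r * max v r ^ 2 * max v r := by gcongr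
          _ = _ := by rw [hρ]
      calc _ = n ^ 2 * ((1 / (gridSize v r : ℝ)) * contactRatio v r / gridSize v r ^ 2) := by
            rw [hKm, cellMean]; ring
        _ ≤ n ^ 2 * (r ^ 2 * max v r) := by gcongr
        _ = _ := by ring
    have hpi1 : 1 ≤ Real.pi := by linarith [Real.pi_gt_three]
    have hnum : B.card * (3072 * cellMean n v r * 303 ^ 2 * (32 * contactRatio v r)) ≤
        32 * 302 * 303 ^ 2 * 3072 ^ 2 * (n ^ 2 * r ^ 2 * max v r) := by
      calc _ ≤ 3072 * cellMean n v r * (302 * gridSize v r) *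
            (3072 * cellMean n v r * 303 ^ 2 * (32 * contactRatio v r)) := by gcongr
        _ = 32 * 302 * 303 ^ 2 * 3072 ^ 2 *
            (cellMean n v r * (gridSize v r : ℝ) * (cellMean n v r * contactRatio v r)) := by ring
        _ ≤ _ := by gcongr
    calc _ ≤ 1 / (n * 1 * r ^ 2) / (n / 12288) *
          (32 * 302 * 303 ^ 2 * 3072 ^ 2 * (n ^ 2 * r ^ 2 * max v r)) := by
          gcongr
          exact hsum.trans hnum
      _ = _ := by
          rw [edgeUpperConst]
          field_simp

theorem le_mobileConductance (hn : 0 < n) (hv : 0 ≤ v) (hv' : v ≤ √2) (hr : 0 < r)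
    (hr' : r ≤ √2) {κ : ℝ} (hκ : 0 < κ) (hnr : κ ≤ n * r ^ 2) (hx : BalancedAt n v r x) :
    edgeConst / (1 / κ + 4000000) * max v r ≤ mobileConductance v r x := by
  obtain ⟨S₀, -⟩ := exists_bisecting_cut hn hv' hr hr' hx
  have : Nonempty (Cut n) := ⟨S₀⟩
  have hd := max_pos_of_range_pos (v := v) hr
  have hn' : (0 : ℝ) < n := by exact_mod_cast hn
  have hρ := contactRatio_mul_sq (v := v) hr
  have hρ0 := contactRatio_nonneg v r
  refine le_ciInf fun S => ?_
  have hS : (0 : ℝ) < S.1.card := by exact_mod_cast Finset.card_pos.2 S.2.1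
  rw [integral_sum_contactProb hv hv' hx.mem_square]
  set W : ℝ := n * r ^ 2 * (1 / κ + 4000000) with hWdef
  have hWpos : 0 < W := by positivity
  have hmr : cellMean n v r * contactRatio v r ≤ n * r ^ 2 / 2304 := by
    have hK0 : (0 : ℝ) < gridSize v r := by
      have := le_gridSize hv' hr hr'
      exact_mod_cast (by omega : 0 < gridSize v r)
    have h1 : contactRatio v r * 2304 ≤ r ^ 2 * (gridSize v r : ℝ) ^ 2 := by
      calc contactRatio v r * 2304 ≤ contactRatio v r * (gridSize v r * max v r) ^ 2 := by
            gcongr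
            have := le_gridSize_mul (v := v) hr
            nlinarith
        _ = contactRatio v r * max v r ^ 2 * (gridSize v r : ℝ) ^ 2 := by ring
        _ = _ := by rw [hρ]
    rw [cellMean, le_div_iff₀ (by norm_num), div_mul_eq_mul_div, div_mul_eq_mul_div,
      div_le_iff₀ (by positivity)]
    nlinarith
  have hW : ∀ i, 1 + 32 * contactRatio v r *
      ((Finset.univ.filter fun k => dist (x i) (x k) ≤ 3 * max v r).card : ℝ) ≤ W := by
    intro i
    have h1 : 1 ≤ n * r ^ 2 * (1 / κ) := by
      rw [mul_one_div, le_div_iff₀ hκ]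
      linarith
    calc _ ≤ 1 + 32 * contactRatio v r * (3072 * cellMean n v r * 303 ^ 2) := by
          gcongr
          exact card_dist_le_le hv' hr hr' hx i
      _ = 1 + 32 * 3072 * 303 ^ 2 * (cellMean n v r * contactRatio v r) := by ring
      _ ≤ 1 + 32 * 3072 * 303 ^ 2 * (n * r ^ 2 / 2304) := by gcongr
      _ ≤ W := by
          rw [hWdef]
          have : 0 < n * r ^ 2 := by positivity
          nlinarith
  have hcontact : (∑ i ∈ S.1, ∑ j ∈ S.1ᶜ, (transition v x).real (nearEvent n r i j)) / W ≤
      ∑ i ∈ S.1, ∑ j ∈ S.1ᶜ, ∫ y, contactProb r y i j ∂(transition v x) := by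
    rw [Finset.sum_div]
    refine Finset.sum_le_sum fun i hi => ?_
    rw [Finset.sum_div]
    refine Finset.sum_le_sum fun j hj => ?_
    have hij : i ≠ j := fun h => Finset.mem_compl.1 hj (h ▸ hi)
    exact le_integral_contactProb hv hv' hr hx.mem_square hij (hW i)
  calc edgeConst / (1 / κ + 4000000) * max v r
      = edgeConst * (n * r ^ 2 * max v r * S.1.card) / W / S.1.card := by
        rw [hWdef]
        field_simp
    _ ≤ _ := by
        gcongr
        refine le_trans ?_ hcontact
        gcongr
        exact le_sum_transition_nearEvent hn hv hv' hr hr' hx S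

/-- For the bisecting cut only the nodes near the dividing line can contact a node across the cut,
and each of them contacts at most one node. -/
theorem mobileConductance_le (hn : 0 < n) (hv : 0 ≤ v) (hv' : v ≤ √2) (hr : 0 < r)
    (hr' : r ≤ √2) (hx : BalancedAt n v r x) :
    mobileConductance v r x ≤ 3072 * 302 * 12288 * max v r := by
  obtain ⟨S, B, hS, hB, hcross⟩ := exists_bisecting_cut hn hv' hr hr' hx
  have hn' : (0 : ℝ) < n := by exact_mod_cast hn
  have hspos : (0 : ℝ) < S.1.card := lt_of_lt_of_le (by positivity) hS
  have := isProbabilityMeasure_transition hv hv' hx.mem_square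
  refine (ciInf_le (Set.finite_range _).bddBelow S).trans ?_
  rw [integral_sum_contactProb hv hv' hx.mem_square]
  have hsum : ∑ i ∈ S.1, ∑ j ∈ S.1ᶜ, ∫ y, contactProb r y i j ∂(transition v x) ≤ B.card := by
    calc _ ≤ ∑ i ∈ S.1, if i ∈ B then (1 : ℝ) else 0 := by
          refine Finset.sum_le_sum fun i hi => ?_
          have hne : ∀ j ∈ S.1ᶜ, i ≠ j := fun j hj h => Finset.mem_compl.1 hj (h ▸ hi)
          have hint : ∀ j ∈ S.1ᶜ, Integrable (fun y => contactProb r y i j) (transition v x) :=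
            fun j hj => integrable_contactProb hv hv' hx.mem_square (hne j hj)
          split_ifs with hiB
          · rw [← integral_finsetSum _ hint]
            calc _ ≤ ∫ _, (1 : ℝ) ∂(transition v x) :=
                  integral_mono (integrable_finsetSum _ hint) (integrable_const _)
                    fun y => sum_contactProb_le_one y i _
              _ = 1 := by simp
          · refine (Finset.sum_eq_zero fun j hj => ?_).le
            refine integral_eq_zero_of_ae ?_
            have h0 := transition_nearEvent_eq_zero (r := r) hv hv' hx.mem_square (hne j hj)
              (not_le.1 fun h => hiB (hcross i hi j hj h))
            filter_upwards [measure_eq_zero_iff_ae_notMem.1 h0] with y hy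
            rw [contactProb_eq_indicator (hne j hj), Set.indicator_of_notMem hy, Pi.zero_apply]
      _ ≤ ∑ i, if i ∈ B then (1 : ℝ) else 0 := by
          refine Finset.sum_le_sum_of_subset_of_nonneg (Finset.subset_univ _) fun i _ _ => ?_
          split_ifs <;> norm_num
      _ = _ := by simp [Finset.sum_ite_mem]
  have hK := inv_gridSize_le hv' hr hr'
  have hKm := gridSize_mul_cellMean_eq (n := n) hv' hr hr'
  calc _ ≤ 3072 * cellMean n v r * (302 * gridSize v r) / (n / 12288) := by
        have hm := cellMean_pos hn hv' hr hr'
        gcongr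
        exact hsum.trans hB
    _ = 3072 * 302 * 12288 * (1 / gridSize v r) * (n / n) := by
        rw [show 3072 * cellMean n v r * (302 * gridSize v r)
          = 3072 * 302 * (cellMean n v r * gridSize v r) by ring, hKm]
        field_simp
    _ ≤ _ := by
        rw [div_self hn'.ne', mul_one]
        gcongr

end Conductance

/-! ### Balanced configurations are typical -/

/-- The constant `10000` is large enough for `cellMean n v r ≥ 10000 log n`, so that the exponential
in Chernoff's bound is at most `n⁻²` and outweighs the number of cells, which is at most `n`. -/
lemma measureReal_configLaw_not_balanced_le {n : ℕ} {v r : ℝ} (hn : 3 ≤ n) (hv : 0 ≤ v)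
    (hv' : v ≤ √2) (hr : 0 < r) (hr' : r ≤ √2) (h : 10000 * √(Real.log n / n) ≤ v + r)
    {μ₀ : Measure Plane} (hμ : μ₀ = uniformLaw ∨ μ₀ = stationaryLaw v) (t : ℕ) :
    (configLaw n v μ₀ t).real {x | ¬ BalancedAt n v r x} ≤ 2 / n := by
  have := isProbabilityMeasure_lawAt hv hv' hμ t
  have hb := lawAt_bounds_uniformLaw hv hv' hμ t
  have hK := le_gridSize hv' hr hr'
  have hK0 : 0 < gridSize v r := by omega
  have hK' : (0 : ℝ) < gridSize v r := by exact_mod_cast hK0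
  have hn' : (0 : ℝ) < n := by exact_mod_cast (by omega : 0 < n)
  have hlog : 1 ≤ Real.log n := by
    rw [Real.le_log_iff_exp_le hn']
    have : (3 : ℝ) ≤ n := by exact_mod_cast hn
    linarith [Real.exp_one_lt_d9]
  have hmK := cellMean_mul_sq (n := n) hv' hr hr'
  have hm : 10000 * Real.log n ≤ cellMean n v r := by
    have h1 : 5000 * √(Real.log n / n) ≤ max v r := by
      linarith [le_max_left v r, le_max_right v r]
    have h2 : 25000000 * (Real.log n / n) ≤ max v r ^ 2 := by
      calc 25000000 * (Real.log n / n) = (5000 * √(Real.log n / n)) ^ 2 := by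
            rw [mul_pow, Real.sq_sqrt (by positivity)]; norm_num
        _ ≤ max v r ^ 2 := by gcongr
    have h3 : 25000000 * Real.log n ≤ n * max v r ^ 2 := by
      calc 25000000 * Real.log n = n * (25000000 * (Real.log n / n)) := by field_simp
        _ ≤ _ := by gcongr
    have h4 : (gridSize v r * max v r) ^ 2 ≤ 2500 := by
      have h5 := gridSize_mul_le hv' hr hr'
      have h6 := le_gridSize_mul (v := v) hr
      nlinarith
    have hm0 : 0 ≤ cellMean n v r := by unfold cellMean; positivity
    have : n * max v r ^ 2 ≤ cellMean n v r * 2500 := by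
      calc n * max v r ^ 2 = cellMean n v r * (gridSize v r * max v r) ^ 2 := by
            rw [← hmK]; ring
        _ ≤ _ := by gcongr
    linarith
  have hKn : (gridSize v r : ℝ) ^ 2 ≤ n := by
    have : 0 ≤ (gridSize v r : ℝ) ^ 2 := by positivity
    nlinarith
  refine (measureReal_not_balanced_le hK0 hb.1 hb.2 rfl).trans ?_
  calc 2 * (gridSize v r : ℝ) ^ 2 * Real.exp (-(cellMean n v r / 4096))
      ≤ 2 * n * Real.exp (-(2 * Real.log n)) := by
        gcongr
        linarith
    _ = 2 / n := by
        rw [Real.exp_neg, two_mul (Real.log n), Real.exp_add, Real.exp_log hn']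
        field_simp

lemma thetaWhp_of_balanced {v r : ℕ → ℝ} {μ₀ : ℕ → Measure Plane} {t : ℕ → ℕ}
    (hadm : Admissible 10000 v r) (hμ : ∀ n, μ₀ n = uniformLaw ∨ μ₀ n = stationaryLaw (v n))
    {Φ : (n : ℕ) → (Fin n → Plane) → ℝ} {g : ℕ → ℝ} {c₁ c₂ : ℝ}
    (h : ∀ᶠ n in atTop, ∀ x, BalancedAt n (v n) (r n) x →
      c₁ * g n ≤ Φ n x ∧ Φ n x ≤ c₂ * g n) :
    ThetaWhp (fun n => configLaw n (v n) (μ₀ n) (t n)) Φ g c₁ c₂ := by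
  have hlim : Tendsto (fun n : ℕ => ENNReal.ofReal (1 - 2 / n)) atTop (𝓝 1) := by
    have h1 : Tendsto (fun n : ℕ => 1 - 2 / (n : ℝ)) atTop (𝓝 (1 - 0)) :=
      tendsto_const_nhds.sub (tendsto_const_div_atTop_nhds_zero_nat 2)
    simpa using ENNReal.tendsto_ofReal h1
  refine tendsto_of_tendsto_of_tendsto_of_le_of_le' hlim tendsto_const_nhds ?_ ?_
  · filter_upwards [hadm, h, eventually_ge_atTop 3] with n hn hΦ hn3
    obtain ⟨hv, hv', hr, hr', hvr⟩ := hn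
    have := isProbabilityMeasure_lawAt hv hv' (hμ n) (t n)
    have hprob : IsProbabilityMeasure (configLaw n (v n) (μ₀ n) (t n)) := by
      unfold configLaw; infer_instance
    have hbad := measureReal_configLaw_not_balanced_le hn3 hv hv' hr hr' hvr (hμ n) (t n)
    refine (ENNReal.ofReal_le_iff_le_toReal (measure_ne_top _ _)).2 ?_
    have hcover : (Set.univ : Set (Fin n → Plane)) ⊆
        {x | c₁ * g n ≤ Φ n x ∧ Φ n x ≤ c₂ * g n} ∪ {x | ¬ BalancedAt n (v n) (r n) x} :=
      fun x _ => (em (BalancedAt n (v n) (r n) x)).imp (hΦ x) id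
    have h1 := (measureReal_mono (μ := configLaw n (v n) (μ₀ n) (t n)) hcover).trans
      (measureReal_union_le _ _)
    rw [probReal_univ] at h1
    rw [← measureReal_def]
    linarith
  · filter_upwards [hadm] with n hn
    have := isProbabilityMeasure_lawAt hn.1 hn.2.1 (hμ n) (t n)
    have hprob : IsProbabilityMeasure (configLaw n (v n) (μ₀ n) (t n)) := by
      unfold configLaw; infer_instance
    exact prob_le_one

end MobileGossip

theorem theorem3 :
    ∃ C₀ : ℝ, 0 < C₀ ∧
      (∃ c₁ c₂ : ℝ, 0 < c₁ ∧ 0 < c₂ ∧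
        ∀ (v r : ℕ → ℝ) (μ₀ : ℕ → Measure MobileGossip.Plane) (t : ℕ → ℕ),
          MobileGossip.Admissible C₀ v r →
          (∀ n, μ₀ n = MobileGossip.uniformLaw ∨ μ₀ n = MobileGossip.stationaryLaw (v n)) →
          MobileGossip.ThetaWhp
            (fun n => MobileGossip.configLaw n (v n) (μ₀ n) (t n))
            (fun n x => MobileGossip.edgeMobileConductance (v n) (r n) x)
            (fun n => max (v n) (r n)) c₁ c₂) ∧
      (∀ κ : ℝ, 0 < κ → ∃ c₁ c₂ : ℝ, 0 < c₁ ∧ 0 < c₂ ∧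
        ∀ (v r : ℕ → ℝ) (μ₀ : ℕ → Measure MobileGossip.Plane) (t : ℕ → ℕ),
          MobileGossip.Admissible C₀ v r →
          (∀ᶠ n : ℕ in atTop, κ ≤ (n : ℝ) * r n ^ 2) →
          (∀ n, μ₀ n = MobileGossip.uniformLaw ∨ μ₀ n = MobileGossip.stationaryLaw (v n)) →
          MobileGossip.ThetaWhp
            (fun n => MobileGossip.configLaw n (v n) (μ₀ n) (t n))
            (fun n x => MobileGossip.mobileConductance (v n) (r n) x)
            (fun n => max (v n) (r n)) c₁ c₂) := by
  refine ⟨10000, by norm_num, ⟨MobileGossip.edgeConst / 4, MobileGossip.edgeUpperConst,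
    div_pos MobileGossip.edgeConst_pos (by norm_num),
    by unfold MobileGossip.edgeUpperConst; norm_num, ?_⟩, ?_⟩
  · intro v r μ₀ t hadm hμ
    refine MobileGossip.thetaWhp_of_balanced hadm hμ ?_
    filter_upwards [hadm, eventually_gt_atTop 0] with n hn hn0 x hx
    exact MobileGossip.edgeMobileConductance_bounds hn0 hn.1 hn.2.1 hn.2.2.1 hn.2.2.2.1 hx
  · intro κ hκ
    refine ⟨MobileGossip.edgeConst / (1 / κ + 4000000), 3072 * 302 * 12288,
      div_pos MobileGossip.edgeConst_pos (by positivity), by norm_num, ?_⟩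
    intro v r μ₀ t hadm hnr hμ
    refine MobileGossip.thetaWhp_of_balanced hadm hμ ?_
    filter_upwards [hadm, hnr, eventually_gt_atTop 0] with n hn hκn hn0 x hx
    exact ⟨MobileGossip.le_mobileConductance hn0 hn.1 hn.2.1 hn.2.2.1 hn.2.2.2.1 hκ hκn hx,
      MobileGossip.mobileConductance_le hn0 hn.1 hn.2.1 hn.2.2.1 hn.2.2.2.1 hx⟩
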